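/- **Setting.** Order the variables of $\mathbb{C}[y_1,\ldots,y_n]$ by $y_1<\dots<y_n$. The leader $\mathrm{ld}(p)$ of a non-constant polynomial $p$ is the greatest variable occurring in $p$; its initial $\mathrm{ini}(p)$ is the coefficient of the highest power of $\mathrm{ld}(p)$ in $p$. An (algebraic) $\sigma$-system $S$ consists of finitely many equations $p=0$ and countably many (finitely or infinitely many) inequations $p\neq 0$ with $p\in\mathbb{C}[y_1,\ldots,y_n]$; $\mathrm{Sol}(S)\subseteq\mathbb{C}^n$ is its solution set, and $S_{<y_i}$ denotes the subsystem of its members lying in $\mathbb{C}[y_1,\ldots,y_{i-1}]$. The $\sigma$-system $S$ is *simple* if * no member of $S$ is constant, and for each $i$ the members of $S$ with leader $y_i$ are either at most one equation (and no inequation) or only inequations (arbitrarily many); * for each member $p$ of $S$ with leader $y_i$ and each $a\in\mathrm{Sol}(S_{<y_i})\subseteq\mathbb{C}^{i-1}$, the initial $\mathrm{ini}(p)$ does not vanish at $a$, and the univariate polynomial $p(a,y_i)$ is square-free; * for any two different inequations $p\ne0$, $q\neq 0$ of $S$ with the same leader $y_i$ and each $a\in\mathrm{Sol}(S_{<y_i})$,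 the polynomials $p(a,y_i)$ and $q(a,y_i)$ have no common zero. Let $\pi_i:\mathbb{C}^n\to\mathbb{C}^i$ be the projection to the first $i$ coordinates; for $V\subseteq\mathbb{C}^n$ regard a fiber of $\pi_i|_V$ as a subset of $\mathbb{C}^{n-i}$. The *counting polynomial* $c(V)\in\mathbb{Z}[\infty]$ of a constructible set $V\subseteq\mathbb{C}^n$ is the value obtained for $V$ by iterated application of the following rules to constructible sets (for all $n$): 1. $c(V)=|V|$ if $V$ is finite; 2. $c(V)=\infty$ if $V$ is an affine line (a one-dimensional affine subspace); 3. $c(V\uplus W)=c(V)+c(W)$ for disjoint constructible $V,W$ (this equation may be used to compute $c(V\uplus W)$ from $c(V),c(W)$, or $c(W)$ from $c(V)$ and $c(V\uplus W)$); 4. if for some $1\le i\le n$ all non-empty fibers $W$ of $\pi_i|_V$ have the same value $c(W)$, then $c(V)=c(W)\cdot c(\pi_i(V))$. An *algebraic counting polynomial* of an arbitrary set $V\subseteq\mathbb{C}^n$ is any element of $\mathbb{Z}[\infty,\aleph_0]$ that can be obtained as a value for $V$ by finitely iterated application of: a constructible set has its counting polynomial as a value; $\infty-\aleph_0$ is a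 value of $\mathbb{C}^1\setminus M$ for each countably infinite $M\subset\mathbb{C}^1$; if $V,W$ are disjoint with values $c,d$, then $c+d$ is a value of $V\uplus W$; if, for some $1\le i\le n$, $c$ is a value of every non-empty fiber of $\pi_i|_V$ and $d$ is a value of $\pi_i(V)$, then $c\cdot d$ is a value of $V$. Such values need not be unique. **Theorem.** Let $S$ be a simple algebraic $\sigma$-system in $\mathbb{C}[y_1,\ldots,y_n]$. Then $\mathrm{Sol}(S)$ has an algebraic counting polynomial in $\mathbb{Z}[\infty,\aleph_0]$. The Zariski closure $\overline{\mathrm{Sol}(S)}$ has a unique counting polynomial $c(\overline{\mathrm{Sol}(S)})\in\mathbb{Z}[\infty]$. For every algebraic counting polynomial $p$ of $\mathrm{Sol}(S)$, considered as a polynomial in $\infty$ with coefficients in $\mathbb{Z}[\aleph_0]$, the degree and the leading coefficient of $p$ equal those of $c(\overline{\mathrm{Sol}(S)})$. In particular, the degree of $p$ in $\infty$ equals the dimension of $\overline{\mathrm{Sol}(S)}$. -/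

import Mathlib

namespace CountingPoly

/-! ### Simple `σ`-systems

The variables `y_1 < y_2 < ... < y_n` are indexed by `Fin n` with its usual order. -/

/-- A `σ`-system over `ℂ[y_1, ..., y_n]`: finitely many equations `p = 0` and countably many
(finitely or infinitely many) inequations `p ≠ 0`. -/
structure SigmaSystem (n : ℕ) where
  eqs : Set (MvPolynomial (Fin n) ℂ)
  ineqs : Set (MvPolynomial (Fin n) ℂ)
  finite_eqs : eqs.Finite
  countable_ineqs : ineqs.Countable

/-- `y_i` is the leader of `p`, the greatest variable that occurs in `p`. -/
def IsLeader {n : ℕ} (p : MvPolynomial (Fin n) ℂ) (i : Fin n) : Prop :=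
  IsGreatest (p.vars : Set (Fin n)) i

/-- The coefficient of the highest power of `y_i` in `p`, a polynomial in the other variables.
When `y_i` is the leader of `p` this is the initial of `p`. -/
noncomputable def initial {n : ℕ} (i : Fin n) (p : MvPolynomial (Fin n) ℂ) :
    MvPolynomial (Fin n) ℂ :=
  ∑ m ∈ p.support with m i = p.degreeOf i, MvPolynomial.monomial (m.erase i) (p.coeff m)

/-- The univariate polynomial obtained from `p` by substituting `a_j` for `y_j`, for all `j ≠ i`. -/
noncomputable def specialize {n : ℕ} (i : Fin n) (a : Fin n → ℂ) (p : MvPolynomial (Fin n) ℂ) :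
    Polynomial ℂ :=
  MvPolynomial.aeval (fun j => if j = i then Polynomial.X else Polynomial.C (a j)) p

namespace SigmaSystem

variable {n : ℕ}

/-- The solution set of `S` in `ℂⁿ`. -/
def solutions (S : SigmaSystem n) : Set (Fin n → ℂ) :=
  {a | (∀ p ∈ S.eqs, MvPolynomial.eval a p = 0) ∧ ∀ p ∈ S.ineqs, MvPolynomial.eval a p ≠ 0}

/-- The subsystem of the equations and inequations of `S` that involve only variables
smaller than `y_i`. It is kept in the same ring: whether `a` solves it depends
only on the coordinates `a_j` with `j < i`. -/
def below (S : SigmaSystem n) (i : Fin n) : SigmaSystem n where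
  eqs := {p ∈ S.eqs | ∀ j ∈ p.vars, j < i}
  ineqs := {p ∈ S.ineqs | ∀ j ∈ p.vars, j < i}
  finite_eqs := S.finite_eqs.subset (Set.sep_subset _ _)
  countable_ineqs := S.countable_ineqs.mono (Set.sep_subset _ _)

/-- No equation or inequation is constant, and for each variable there is either
at most one equation with this leader and no inequation, or there are only inequations. -/
def WeaklyTriangular (S : SigmaSystem n) : Prop :=
  (∀ p ∈ S.eqs ∪ S.ineqs, p.vars.Nonempty) ∧
  ∀ i : Fin n,
    ({p ∈ S.eqs | IsLeader p i}.Subsingleton ∧ {p ∈ S.ineqs | IsLeader p i} = ∅) ∨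
      {p ∈ S.eqs | IsLeader p i} = ∅

/-- No initial vanishes at a solution of the subsystem in the variables below the leader. -/
def NonvanishingInitials (S : SigmaSystem n) : Prop :=
  ∀ p ∈ S.eqs ∪ S.ineqs, ∀ i, IsLeader p i →
    ∀ a ∈ (S.below i).solutions, MvPolynomial.eval a (initial i p) ≠ 0

/-- Substituting a solution of the subsystem in the variables below the leader gives a
square-free univariate polynomial. -/
def SquareFree (S : SigmaSystem n) : Prop :=
  ∀ p ∈ S.eqs ∪ S.ineqs, ∀ i, IsLeader p i →
    ∀ a ∈ (S.below i).solutions, Squarefree (specialize i a p)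

/-- Two different inequations with the same leader have no common zero over a solution of the
subsystem in the variables below the leader. -/
def DisjointInequations (S : SigmaSystem n) : Prop :=
  ∀ p ∈ S.ineqs, ∀ q ∈ S.ineqs, p ≠ q → ∀ i, IsLeader p i → IsLeader q i →
    ∀ a ∈ (S.below i).solutions,
      ¬ (MvPolynomial.eval a p = 0 ∧ MvPolynomial.eval a q = 0)

/-- Simple `σ`-systems. -/
structure IsSimple (S : SigmaSystem n) : Prop where
  weaklyTriangular : S.WeaklyTriangular
  nonvanishingInitials : S.NonvanishingInitials
  squareFree : S.SquareFree
  disjointInequations : S.DisjointInequations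

end SigmaSystem

/-! ### Zariski topology on `ℂⁿ` -/

/-- Constructible subsets of `ℂⁿ`: Boolean combinations of zero sets of polynomials. -/
def IsConstructible {n : ℕ} (V : Set (Fin n → ℂ)) : Prop :=
  V ∈ BooleanSubalgebra.closure
    {Z : Set (Fin n → ℂ) | ∃ p : MvPolynomial (Fin n) ℂ, Z = {a | MvPolynomial.eval a p = 0}}

/-- The Zariski closure of a subset of `ℂⁿ`. -/
def zariskiClosure {n : ℕ} (V : Set (Fin n → ℂ)) : Set (Fin n → ℂ) :=
  MvPolynomial.zeroLocus ℂ (MvPolynomial.vanishingIdeal ℂ V)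

/-- The dimension of a Zariski closed subset of `ℂⁿ`: the Krull dimension of its coordinate
ring. -/
noncomputable def zariskiDim {n : ℕ} (V : Set (Fin n → ℂ)) : WithBot ℕ∞ :=
  ringKrullDim (MvPolynomial (Fin n) ℂ ⧸ MvPolynomial.vanishingIdeal ℂ V)

/-! ### Counting polynomials -/

/-- The projection `π_m : ℂᵐ⁺ᵏ → ℂᵐ` to the first `m` coordinates. -/
def proj (m k : ℕ) (v : Fin (m + k) → ℂ) : Fin m → ℂ := fun j => v (Fin.castAdd k j)

/-- The fiber over `w` of the restriction of `π_m` to `V`, as a subset of `ℂᵏ`. -/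
def fiber {m k : ℕ} (V : Set (Fin (m + k) → ℂ)) (w : Fin m → ℂ) : Set (Fin k → ℂ) :=
  {u | Fin.append w u ∈ V}

/-- `V` is an affine line (an affine subspace of dimension one) in `ℂⁿ`. -/
def IsAffineLine {n : ℕ} (V : Set (Fin n → ℂ)) : Prop :=
  ∃ L : AffineSubspace ℂ (Fin n → ℂ), Module.finrank ℂ L.direction = 1 ∧ V = L

/-- `IsPleskenCounting V c`: the four rules for the counting polynomial of constructible sets
give the value `c ∈ ℤ[∞]` for `V`. The indeterminate `∞` is `Polynomial.X`. The additivity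
`c(V ⊎ W) = c(V) + c(W)` may be used in both directions (`union` and `diff`). -/
inductive IsPleskenCounting : ∀ {n : ℕ}, Set (Fin n → ℂ) → Polynomial ℤ → Prop
  | finite {n : ℕ} (V : Set (Fin n → ℂ)) (hV : V.Finite) :
      IsPleskenCounting V (Polynomial.C (V.ncard : ℤ))
  | line {n : ℕ} (V : Set (Fin n → ℂ)) (hV : IsAffineLine V) :
      IsPleskenCounting V Polynomial.X
  | union {n : ℕ} (V W : Set (Fin n → ℂ)) (c d : Polynomial ℤ)
      (hV : IsConstructible V) (hW : IsConstructible W) (h : Disjoint V W)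
      (hc : IsPleskenCounting V c) (hd : IsPleskenCounting W d) :
      IsPleskenCounting (V ∪ W) (c + d)
  | diff {n : ℕ} (V W : Set (Fin n → ℂ)) (c e : Polynomial ℤ)
      (hV : IsConstructible V) (hW : IsConstructible W) (h : Disjoint V W)
      (hc : IsPleskenCounting V c) (he : IsPleskenCounting (V ∪ W) e) :
      IsPleskenCounting W (e - c)
  | fibration {m k : ℕ} (hm : 1 ≤ m) (V : Set (Fin (m + k) → ℂ)) (c d : Polynomial ℤ)
      (hV : IsConstructible V)
      (hc : ∀ w ∈ proj m k '' V, IsPleskenCounting (fiber V w) c)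
      (hd : IsPleskenCounting (proj m k '' V) d) :
      IsPleskenCounting V (c * d)

/-- `ℤ[∞, ℵ₀]`, as polynomials in `∞` with coefficients in `ℤ[ℵ₀]`. -/
abbrev CountingRing : Type := Polynomial (Polynomial ℤ)

/-- The indeterminate `∞`. -/
noncomputable def infty : CountingRing := Polynomial.X

/-- The indeterminate `ℵ₀`. -/
noncomputable def aleph : CountingRing := Polynomial.C Polynomial.X

/-- The inclusion of `ℤ[∞]` in `ℤ[∞, ℵ₀]`. -/
noncomputable def inclusion : Polynomial ℤ →+* CountingRing :=
  Polynomial.mapRingHom Polynomial.C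

/-- `IsAlgCounting V c`: the element `c ∈ ℤ[∞, ℵ₀]` is an algebraic counting polynomial of the
arbitrary set `V ⊆ ℂⁿ`. The values are built up from the counting polynomials of constructible
sets and the rule `c(ℂ¹ \ M) = ∞ - ℵ₀` for countably infinite `M`, by adding values of disjoint
sets and by multiplying the value of the base with the common value of the fibers. -/
inductive IsAlgCounting : ∀ {n : ℕ}, Set (Fin n → ℂ) → CountingRing → Prop
  | constructible {n : ℕ} (V : Set (Fin n → ℂ)) (c : Polynomial ℤ) (hV : IsConstructible V)
      (hc : IsPleskenCounting V c) :
      IsAlgCounting V (inclusion c)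
  | cocountable (M : Set (Fin 1 → ℂ)) (hM : M.Countable) (hM' : M.Infinite) :
      IsAlgCounting Mᶜ (infty - aleph)
  | union {n : ℕ} (V W : Set (Fin n → ℂ)) (c d : CountingRing) (h : Disjoint V W)
      (hc : IsAlgCounting V c) (hd : IsAlgCounting W d) :
      IsAlgCounting (V ∪ W) (c + d)
  | fibration {m k : ℕ} (hm : 1 ≤ m) (V : Set (Fin (m + k) → ℂ)) (c d : CountingRing)
      (hc : ∀ w ∈ proj m k '' V, IsAlgCounting (fiber V w) c)
      (hd : IsAlgCounting (proj m k '' V) d) :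
      IsAlgCounting V (c * d)

end CountingPoly

namespace CountingPoly

open Polynomial

/-! ### Iterated integration over the coordinates -/

/-! A counting polynomial is an integral. Integrate the indicator function of `V` one coordinate at
a time, the last coordinate innermost, where a function `f` on ℂ that equals `g` off a finite set
`s` has integral `g * X + ∑ w ∈ s, (f w - g)`. The result depends only on the set
(`HasCount.unique`), and each of the four rules computes it (`IsPleskenCounting.hasCount`), the
fibration rule being Fubini. So counting polynomials are unique. They exist for constructible sets
(`IsConstructible.exists_isPleskenCounting`), because the number of zeros of a polynomial in the
last variable is a constructible function of the other variables.

For algebraic counting polynomials the exceptional sets may be countable instead of finite. Since ℂ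
is uncountable, leading terms survive: `leadIntegral` retains only degree and leading coefficient,
and the leading coefficients are natural numbers, so nothing cancels. Every algebraic counting
polynomial has the leading term of such an integral (`IsAlgCounting.exists_hasLead`).

For a simple system let `D i` be the degree of the equation with leader `y_i`, or `0` if there is
none. Each partial solution extends to the next coordinate in exactly `D i` ways, or by all but
countably many values if `D i = 0`. Hence the leading term for the solutions is `N * X ^ d`, with
`N` the product of the nonzero `D i` and `d` the number of vanishing ones (`leadEq_solutions`).

The Zariski closure contains the solutions, which bounds its leading term from below. From above,
let `h` be the product of the initials of the equations. Off `h = 0` the equations again give the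
bound `N * X ^ d`. As `h` is a nonzerodivisor on the coordinate ring, the part with `h = 0` has
dimension below `d`, so its counting polynomial has degree below `d`
(`degree_lt_of_ringKrullDim_lt`). The same lemma shows that the closure has dimension at least `d`;
the equations, having nonzerodivisors as initials, show that it is at most `d`. -/

/-- The slice of `V` over the value `w` of the first coordinate. -/
def slice {n : ℕ} (w : ℂ) (V : Set (Fin (n + 1) → ℂ)) : Set (Fin n → ℂ) :=
  {u | (Fin.cons w u : Fin (n + 1) → ℂ) ∈ V}

@[simp] theorem mem_slice {n : ℕ} {w : ℂ} {V : Set (Fin (n + 1) → ℂ)} {u : Fin n → ℂ} :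
    u ∈ slice w V ↔ (Fin.cons w u : Fin (n + 1) → ℂ) ∈ V := Iff.rfl

/-- `a` is a value of `V` with respect to the integration relation `I` (`I f a` meaning that `a`
is an integral of the function `f` on `ℂ`), iterated over the coordinates. -/
def IsIterated {A : Type*} [Semiring A] (I : (ℂ → A) → A → Prop) :
    (n : ℕ) → Set (Fin n → ℂ) → A → Prop
  | 0, V, a => (V.Nonempty → a = 1) ∧ (V = ∅ → a = 0)
  | n + 1, V, a => ∃ f : ℂ → A, (∀ w, IsIterated I n (slice w V) (f w)) ∧ I f a

/-- Linearity of an integration relation. -/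
structure IsLinearIntegral {A : Type*} [Semiring A] (I : (ℂ → A) → A → Prop) : Prop where
  zero : I (fun _ => 0) 0
  add : ∀ {f g a b}, I f a → I g b → I (fun w => f w + g w) (a + b)
  mul : ∀ {f a} (c), I f a → I (fun w => c * f w) (c * a)

theorem slice_disjoint {n : ℕ} (w : ℂ) {V W : Set (Fin (n + 1) → ℂ)} (h : Disjoint V W) :
    Disjoint (slice w V) (slice w W) :=
  Set.disjoint_left.2 fun _ hu hu' => Set.disjoint_left.1 h hu hu'

theorem append_cons_cast {m k N : ℕ} (h : N + 1 = m + 1 + k) (h' : N = m + k) (w : ℂ)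
    (v : Fin m → ℂ) (u : Fin k → ℂ) :
    (Fin.append (Fin.cons w v : Fin (m + 1) → ℂ) u) ∘ Fin.cast h =
      Fin.cons w (Fin.append v u ∘ Fin.cast h') := by
  subst h'
  rw [Fin.append_cons]
  ext x
  simp

section Iterated

variable {A : Type*} [Semiring A] {I : (ℂ → A) → A → Prop}

theorem IsIterated.empty (hI : IsLinearIntegral I) : ∀ n : ℕ, IsIterated I n ∅ 0
  | 0 => ⟨fun h => by simp at h, fun _ => rfl⟩
  | n + 1 => ⟨fun _ => 0, fun _ => IsIterated.empty hI n, hI.zero⟩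

theorem IsIterated.union (hI : IsLinearIntegral I) : ∀ {n : ℕ} {V W : Set (Fin n → ℂ)} {a b : A},
    Disjoint V W → IsIterated I n V a → IsIterated I n W b → IsIterated I n (V ∪ W) (a + b)
  | 0, V, W, a, b, h, ha, hb => by
    rcases V.eq_empty_or_nonempty with hV | hV <;> rcases W.eq_empty_or_nonempty with hW | hW
    · simp [hV, hW, IsIterated, ha.2 hV, hb.2 hW]
    · simp [hV, IsIterated, ha.2 hV, hb.1 hW, hW, hW.ne_empty]
    · simp [hW, IsIterated, ha.1 hV, hb.2 hW, hV, hV.ne_empty]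
    · obtain ⟨v, hv⟩ := hV
      obtain ⟨w, hw⟩ := hW
      exact (Set.disjoint_left.1 h hv (Subsingleton.elim w v ▸ hw)).elim
  | n + 1, V, W, a, b, h, ⟨f, hf, hfa⟩, ⟨g, hg, hgb⟩ =>
    ⟨_, fun w => IsIterated.union hI (slice_disjoint w h) (hf w) (hg w), hI.add hfa hgb⟩

/-- Fubini, from linearity of `I` alone: the first coordinate of the base is peeled off `m` times,
until the base is empty or a point. The length `N` is a variable with a cast because `m + 1 + k` and
`m + k + 1` are not definitionally equal. -/
theorem IsIterated.fibration_cast (hI : IsLinearIntegral I) :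
    ∀ {m k N : ℕ} (h : N = m + k) {V : Set (Fin N → ℂ)} {B : Set (Fin m → ℂ)} {c d : A},
      IsIterated I m B d →
      (∀ w ∈ B, IsIterated I k {u | Fin.append w u ∘ Fin.cast h ∈ V} c) →
      (∀ w u, Fin.append w u ∘ Fin.cast h ∈ V → w ∈ B) → IsIterated I N V (c * d)
  | 0, k, N, h, V, B, c, d, hd, hc, hB => by
    obtain rfl : N = k := by omega
    have e : ∀ (w : Fin 0 → ℂ) (u : Fin N → ℂ), Fin.append w u ∘ Fin.cast h = u := by
      intro w u
      rw [Subsingleton.elim w Fin.elim0, Fin.elim0_append]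
      ext x
      simp
    simp only [e] at hc hB
    rcases B.eq_empty_or_nonempty with h0 | ⟨w, hw⟩
    · have : V = ∅ := Set.eq_empty_iff_forall_notMem.2 fun u hu => by
        simpa [h0] using hB Fin.elim0 u hu
      rw [hd.2 h0, this, mul_zero]
      exact IsIterated.empty hI N
    · rw [hd.1 ⟨w, hw⟩, mul_one]
      exact hc w hw
  | m + 1, k, N, h, V, B, c, d, ⟨f, hf, hfd⟩, hc, hB => by
    obtain ⟨N, rfl⟩ : ∃ N', N = N' + 1 := ⟨m + k, by omega⟩
    have h' : N = m + k := by omega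
    refine ⟨fun w => c * f w, fun w => ?_, hI.mul c hfd⟩
    refine IsIterated.fibration_cast hI h' (hf w) (fun v hv => ?_) fun v u hu => ?_
    · simpa only [append_cons_cast h h', mem_slice] using hc _ hv
    · refine hB _ u ?_
      rwa [append_cons_cast h h']

theorem IsIterated.fibration (hI : IsLinearIntegral I) {m k : ℕ} {V : Set (Fin (m + k) → ℂ)}
    {c d : A} (hd : IsIterated I m (proj m k '' V) d)
    (hc : ∀ w ∈ proj m k '' V, IsIterated I k (fiber V w) c) : IsIterated I (m + k) V (c * d) := by
  refine IsIterated.fibration_cast hI rfl hd (fun w hw => hc w hw) fun w u hu => ⟨_, hu, ?_⟩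
  ext j
  simp [proj]

end Iterated

/-! ### The counting polynomial as an iterated integral -/

/-- The integral of a function `ℂ → ℤ[∞]` with the constant value `g` off a finite set. -/
def countIntegral (f : ℂ → ℤ[X]) (a : ℤ[X]) : Prop :=
  ∃ (g : ℤ[X]) (s : Finset ℂ), (∀ w ∉ s, f w = g) ∧ a = g * X + ∑ w ∈ s, (f w - g)

/-- `c` is the iterated integral of the indicator function of `V`. -/
abbrev HasCount {n : ℕ} (V : Set (Fin n → ℂ)) (c : ℤ[X]) : Prop :=
  IsIterated countIntegral n V c

/-- Points with `f w = g` contribute zero, so exceptional sets can be enlarged and two of them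
merged. -/
theorem sum_sub_eq_of_subset {f : ℂ → ℤ[X]} {g : ℤ[X]} {s t : Finset ℂ} (hs : ∀ w ∉ s, f w = g)
    (h : s ⊆ t) : ∑ w ∈ s, (f w - g) = ∑ w ∈ t, (f w - g) :=
  Finset.sum_subset h fun w _ hw => by rw [hs w hw, sub_self]

theorem countIntegral.add {f f' : ℂ → ℤ[X]} {a a' : ℤ[X]} :
    countIntegral f a → countIntegral f' a' → countIntegral (fun w => f w + f' w) (a + a') := by
  rintro ⟨g, s, hs, rfl⟩ ⟨g', s', hs', rfl⟩
  classical
  refine ⟨g + g', s ∪ s', fun w hw => ?_, ?_⟩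
  · rw [Finset.notMem_union] at hw
    simp only [hs w hw.1, hs' w hw.2]
  · rw [sum_sub_eq_of_subset hs (t := s ∪ s') Finset.subset_union_left,
      sum_sub_eq_of_subset hs' (t := s ∪ s') Finset.subset_union_right]
    simp only [add_sub_add_comm, Finset.sum_add_distrib]
    ring

theorem countIntegral.mul {f : ℂ → ℤ[X]} {a : ℤ[X]} (c : ℤ[X]) :
    countIntegral f a → countIntegral (fun w => c * f w) (c * a) := by
  rintro ⟨g, s, hs, rfl⟩
  refine ⟨c * g, s, fun w hw => by simp only [hs w hw], ?_⟩
  simp only [← mul_sub, ← Finset.mul_sum]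
  ring

theorem countIntegral_linear : IsLinearIntegral countIntegral where
  zero := ⟨0, ∅, by simp, by simp⟩
  add := countIntegral.add
  mul := countIntegral.mul

/-- Two finite exceptional sets do not exhaust ℂ, so the generic value is determined. -/
theorem countIntegral.unique {f : ℂ → ℤ[X]} {a b : ℤ[X]} :
    countIntegral f a → countIntegral f b → a = b := by
  rintro ⟨g, s, hs, rfl⟩ ⟨g', s', hs', rfl⟩
  classical
  obtain ⟨w, hw⟩ := Infinite.exists_notMem_finset (s ∪ s')
  rw [Finset.notMem_union] at hw
  obtain rfl : g = g' := (hs w hw.1).symm.trans (hs' w hw.2)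
  rw [sum_sub_eq_of_subset hs (t := s ∪ s') Finset.subset_union_left,
    sum_sub_eq_of_subset hs' (t := s ∪ s') Finset.subset_union_right]

theorem countIntegral_const (a : ℤ[X]) : countIntegral (fun _ => a) (a * X) :=
  ⟨a, ∅, by simp, by simp⟩

theorem countIntegral_single (w₀ : ℂ) (a : ℤ[X]) :
    countIntegral (fun w => if w = w₀ then a else 0) a :=
  ⟨0, {w₀}, fun w hw => if_neg (by simpa using hw), by simp⟩

namespace HasCount

theorem unique : ∀ {n : ℕ} {V : Set (Fin n → ℂ)} {a b : ℤ[X]},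
    HasCount V a → HasCount V b → a = b
  | 0, V, a, b, ha, hb => by
    rcases V.eq_empty_or_nonempty with h | h
    · rw [ha.2 h, hb.2 h]
    · rw [ha.1 h, hb.1 h]
  | n + 1, V, a, b, ⟨f, hf, hfa⟩, ⟨g, hg, hgb⟩ => by
    obtain rfl : f = g := funext fun w => unique (hf w) (hg w)
    exact hfa.unique hgb

theorem diff : ∀ {n : ℕ} {V W : Set (Fin n → ℂ)} {c e : ℤ[X]}, Disjoint V W →
    HasCount V c → HasCount (V ∪ W) e → HasCount W (e - c)
  | 0, V, W, c, e, h, hc, he => by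
    rcases V.eq_empty_or_nonempty with hV | hV
    · subst hV
      rw [Set.empty_union] at he
      rwa [hc.2 rfl, sub_zero]
    · have hW : W = ∅ := Set.eq_empty_iff_forall_notMem.2 fun w hw => by
        obtain ⟨v, hv⟩ := hV
        exact Set.disjoint_left.1 h hv (Subsingleton.elim w v ▸ hw)
      subst hW
      rw [Set.union_empty] at he
      rw [he.unique hc, sub_self]
      exact IsIterated.empty countIntegral_linear 0
  | n + 1, V, W, c, e, h, ⟨f, hf, hfc⟩, ⟨g, hg, hge⟩ => by
    refine ⟨fun w => g w - f w, fun w => diff (slice_disjoint w h) (hf w) (hg w), ?_⟩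
    have := hge.add (hfc.mul (-1))
    simpa only [neg_mul, one_mul, ← sub_eq_add_neg] using this

theorem singleton : ∀ {n : ℕ} (v : Fin n → ℂ), HasCount {v} 1
  | 0, v => ⟨fun _ => rfl, fun h => by simp at h⟩
  | n + 1, v => by
    refine ⟨_, fun w => ?_, countIntegral_single (v 0) 1⟩
    split_ifs with h
    · have : slice w {v} = {Fin.tail v} := by
        ext u
        subst h
        rw [mem_slice, Set.mem_singleton_iff, Set.mem_singleton_iff]
        exact ⟨fun h => by rw [← h, Fin.tail_cons], fun h => by rw [h, Fin.cons_self_tail]⟩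
      rw [this]
      exact singleton _
    · have : slice w {v} = ∅ := Set.eq_empty_iff_forall_notMem.2 fun u hu => h <| by
        rw [← Set.mem_singleton_iff.1 hu, Fin.cons_zero]
      rw [this]
      exact IsIterated.empty countIntegral_linear n

theorem finite {n : ℕ} {V : Set (Fin n → ℂ)} (hV : V.Finite) : HasCount V (C (V.ncard : ℤ)) := by
  induction V, hV using Set.Finite.induction_on with
  | empty => simpa using IsIterated.empty countIntegral_linear n
  | @insert v V hv hV ih =>
    have := IsIterated.union countIntegral_linear (Set.disjoint_singleton_left.2 hv)
      (singleton v) ih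
    rw [Set.singleton_union] at this
    rw [Set.ncard_insert_of_notMem hv hV]
    simpa [add_comm] using this

theorem line : ∀ {n : ℕ} (p v : Fin n → ℂ), v ≠ 0 → HasCount (Set.range fun t : ℂ => p + t • v) X
  | 0, p, v, hv => (hv (Subsingleton.elim _ _)).elim
  | n + 1, p, v, hv => by
    -- If `v 0 = 0` the line lies over the single value `p 0`. Otherwise every slice is one point,
    -- and the integral of `1` is `X`.
    by_cases h0 : v 0 = 0
    · refine ⟨_, fun w => ?_, countIntegral_single (p 0) X⟩
      split_ifs with h
      · have : slice w (Set.range fun t : ℂ => p + t • v) =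
            Set.range fun t : ℂ => Fin.tail p + t • Fin.tail v := by
          ext u
          simp only [mem_slice, Set.mem_range]
          refine exists_congr fun t => ?_
          constructor
          · intro e
            rw [← Fin.tail_cons (α := fun _ => ℂ) w u, ← e]
            rfl
          · rintro rfl
            ext j
            refine Fin.cases ?_ (fun j => ?_) j <;> simp [h0, h, Fin.tail]
        rw [this]
        refine line _ _ fun e => hv ?_
        ext j
        refine Fin.cases h0 (fun j => ?_) j
        exact congrFun e j
      · have : slice w (Set.range fun t : ℂ => p + t • v) = ∅ := by
          refine Set.eq_empty_iff_forall_notMem.2 ?_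
          rintro u ⟨t, ht⟩
          refine h ?_
          simpa [h0] using (congrFun ht 0).symm
        rw [this]
        exact IsIterated.empty countIntegral_linear n
    · refine ⟨fun _ => 1, fun w => ?_, by simpa using countIntegral_const 1⟩
      have : slice w (Set.range fun t : ℂ => p + t • v) =
          {Fin.tail p + ((w - p 0) / v 0) • Fin.tail v} := by
        ext u
        simp only [mem_slice, Set.mem_range, Set.mem_singleton_iff]
        constructor
        · rintro ⟨t, ht⟩
          have h1 : p 0 + t * v 0 = w := by simpa using congrFun ht 0
          have : t = (w - p 0) / v 0 := by
            rw [← h1]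
            field_simp
            ring
          rw [← this, ← Fin.tail_cons (α := fun _ => ℂ) w u, ← ht]
          rfl
        · rintro rfl
          refine ⟨(w - p 0) / v 0, ?_⟩
          ext j
          refine Fin.cases ?_ (fun j => ?_) j
          · simp [h0]
          · simp [Fin.tail]
      rw [this]
      exact singleton _

end HasCount

theorem IsAffineLine.exists_range {n : ℕ} {V : Set (Fin n → ℂ)} (hV : IsAffineLine V) :
    ∃ p v : Fin n → ℂ, v ≠ 0 ∧ V = Set.range fun t : ℂ => p + t • v := by
  obtain ⟨L, hL, rfl⟩ := hV
  obtain ⟨v, hv, hv'⟩ := finrank_eq_one_iff'.1 hL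
  have hne : (L : Set (Fin n → ℂ)).Nonempty := by
    rw [AffineSubspace.nonempty_iff_ne_bot]
    rintro rfl
    rw [AffineSubspace.direction_bot, finrank_bot] at hL
    exact zero_ne_one hL
  obtain ⟨p, hp⟩ := hne
  refine ⟨p, v, by simpa using hv, ?_⟩
  ext x
  constructor
  · intro hx
    obtain ⟨c, hc⟩ := hv' ⟨x -ᵥ p, AffineSubspace.vsub_mem_direction hx hp⟩
    refine ⟨c, ?_⟩
    have h : c • (v : Fin n → ℂ) = x - p := congrArg Subtype.val hc
    simp [h]
  · rintro ⟨t, rfl⟩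
    have := AffineSubspace.vadd_mem_of_mem_direction (L.direction.smul_mem t v.2) hp
    simpa [add_comm] using this

theorem IsPleskenCounting.hasCount {n : ℕ} {V : Set (Fin n → ℂ)} {c : ℤ[X]}
    (h : IsPleskenCounting V c) : HasCount V c := by
  induction h with
  | finite V hV => exact HasCount.finite hV
  | line V hV =>
    obtain ⟨p, v, hv, rfl⟩ := hV.exists_range
    exact HasCount.line p v hv
  | union V W c d _ _ h _ _ ihc ihd => exact IsIterated.union countIntegral_linear h ihc ihd
  | diff V W c e _ _ h _ _ ihc ihe => exact HasCount.diff h ihc ihe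
  | fibration _ V c d _ _ _ ihc ihd => exact IsIterated.fibration countIntegral_linear ihd ihc

end CountingPoly

namespace CountingPoly

open Polynomial

/-! ### Leading terms -/

/-- `p` and `q` have the same degree and the same leading coefficient. -/
def LeadEq {R : Type*} [Semiring R] (p : R[X]) (q : ℕ[X]) : Prop :=
  p.degree = q.degree ∧ p.leadingCoeff = (q.leadingCoeff : R)

theorem degree_le_of_coeff_le {p q : ℕ[X]} (h : ∀ j, p.coeff j ≤ q.coeff j) :
    p.degree ≤ q.degree := by
  rw [degree_le_iff_coeff_zero]
  intro m hm
  have := h m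
  rw [coeff_eq_zero_of_degree_lt hm] at this
  omega

theorem degree_le_degree_add_right (p q : ℕ[X]) : p.degree ≤ (p + q).degree :=
  degree_le_of_coeff_le fun j => by rw [coeff_add]; omega

theorem degree_le_degree_add_left (p q : ℕ[X]) : q.degree ≤ (p + q).degree :=
  degree_le_of_coeff_le fun j => by rw [coeff_add]; omega

namespace LeadEq

section

variable {R : Type*} [Semiring R] {p p' : R[X]} {q q' : ℕ[X]}

theorem rfl_nat (q : ℕ[X]) : LeadEq q q := ⟨rfl, by simp⟩

theorem zero : LeadEq (0 : R[X]) 0 := ⟨by simp, by simp⟩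

theorem one [Nontrivial R] : LeadEq (1 : R[X]) 1 := ⟨by simp, by simp⟩

theorem X [Nontrivial R] : LeadEq (X : R[X]) Polynomial.X := ⟨by simp, by simp⟩

theorem eq_zero_iff (h : LeadEq p q) : p = 0 ↔ q = 0 := by
  rw [← degree_eq_bot, ← degree_eq_bot, h.1]

theorem trans (h : LeadEq p q) (h' : LeadEq q q') : LeadEq p q' :=
  ⟨h.1.trans h'.1, by rw [h.2, h'.2]; simp⟩

theorem symm {q q' : ℕ[X]} (h : LeadEq q q') : LeadEq q' q :=
  ⟨h.1.symm, by rw [h.2]; simp⟩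

theorem add_right_of_degree_lt (h : LeadEq p q) (hd : p'.degree < p.degree) :
    LeadEq (p + p') q :=
  ⟨by rw [degree_add_eq_left_of_degree_lt hd, h.1],
    by rw [leadingCoeff_add_of_degree_lt' hd, h.2]⟩

/-- Natural leading coefficients cannot cancel in characteristic zero. This is why leading terms are
compared with polynomials over ℕ. -/
theorem add [CharZero R] (h : LeadEq p q) (h' : LeadEq p' q') : LeadEq (p + p') (q + q') := by
  rcases lt_trichotomy q.degree q'.degree with hd | hd | hd
  · have hd' : p.degree < p'.degree := by rwa [h.1, h'.1]
    exact ⟨by rw [degree_add_eq_right_of_degree_lt hd', degree_add_eq_right_of_degree_lt hd, h'.1],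
      by rw [leadingCoeff_add_of_degree_lt hd', leadingCoeff_add_of_degree_lt hd, h'.2]⟩
  · by_cases hq : q = 0
    · have hq' : q' = 0 := by rw [← degree_eq_bot, ← hd, hq, degree_zero]
      rw [h.eq_zero_iff.2 hq, h'.eq_zero_iff.2 hq', hq, hq', add_zero, add_zero]
      exact zero
    · have hn : q.leadingCoeff + q'.leadingCoeff ≠ 0 := by
        have := leadingCoeff_ne_zero.2 hq
        omega
      have hn' : p.leadingCoeff + p'.leadingCoeff ≠ 0 := by
        rw [h.2, h'.2, ← Nat.cast_add]
        exact_mod_cast hn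
      have hd' : p.degree = p'.degree := by rw [h.1, h'.1, hd]
      refine ⟨?_, ?_⟩
      · rw [degree_add_eq_of_leadingCoeff_add_ne_zero hn,
          degree_add_eq_of_leadingCoeff_add_ne_zero hn', h.1, h'.1]
      · rw [leadingCoeff_add_of_degree_eq hd hn, leadingCoeff_add_of_degree_eq hd' hn', h.2, h'.2]
        simp
  · have hd' : p'.degree < p.degree := by rwa [h.1, h'.1]
    exact ⟨by rw [degree_add_eq_left_of_degree_lt hd', degree_add_eq_left_of_degree_lt hd, h.1],
      by rw [leadingCoeff_add_of_degree_lt' hd', leadingCoeff_add_of_degree_lt' hd, h.2]⟩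

theorem mul [NoZeroDivisors R] (h : LeadEq p q) (h' : LeadEq p' q') :
    LeadEq (p * p') (q * q') :=
  ⟨by rw [degree_mul, degree_mul, h.1, h'.1], by
    rw [leadingCoeff_mul, leadingCoeff_mul, h.2, h'.2, Nat.cast_mul]⟩

theorem sum [CharZero R] {ι : Type*} (s : Finset ι) {p : ι → R[X]} {q : ι → ℕ[X]}
    (h : ∀ i ∈ s, LeadEq (p i) (q i)) : LeadEq (∑ i ∈ s, p i) (∑ i ∈ s, q i) := by
  classical
  induction s using Finset.induction_on with
  | empty => simpa using zero
  | insert a s ha ih =>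
    rw [Finset.sum_insert ha, Finset.sum_insert ha]
    exact (h a (Finset.mem_insert_self a s)).add
      (ih fun i hi => h i (Finset.mem_insert_of_mem hi))

theorem natDegree_eq (h : LeadEq p q) : p.natDegree = q.natDegree :=
  natDegree_eq_natDegree h.1

theorem coeff_eq {q q' : ℕ[X]} (h : LeadEq q q') {d : ℕ} (hd : q.natDegree ≤ d) :
    q.coeff d = q'.coeff d := by
  rcases hd.eq_or_lt with rfl | hd
  · conv_rhs => rw [h.natDegree_eq]
    simpa using h.2
  · rw [coeff_eq_zero_of_natDegree_lt hd, coeff_eq_zero_of_natDegree_lt (h.natDegree_eq ▸ hd)]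

end

end LeadEq

/-- The leading term of the integral of a function `f` whose leading term is that of `g` off a
countable set and whose degree is at most that of `g` off a finite set. -/
def leadIntegral (f : ℂ → ℕ[X]) (a : ℕ[X]) : Prop :=
  ∃ (g : ℕ[X]) (s : Finset ℂ), {w | ¬ LeadEq (f w) g}.Countable ∧
    (∀ w ∉ s, (f w).degree ≤ g.degree) ∧ LeadEq a (g * X + ∑ w ∈ s, f w)

/-- The leading term of an iterated integral of the indicator function of `V`. -/
abbrev HasLead {n : ℕ} (V : Set (Fin n → ℂ)) (q : ℕ[X]) : Prop :=
  IsIterated leadIntegral n V q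

/-- The new terms have degree at most that of `g`, hence below that of `g * X`; if `g = 0` they
vanish. -/
theorem leadEq_add_sum_of_subset {f : ℂ → ℕ[X]} {g : ℕ[X]} {s t : Finset ℂ}
    (hs : ∀ w ∉ s, (f w).degree ≤ g.degree) (h : s ⊆ t) :
    LeadEq (g * X + ∑ w ∈ s, f w) (g * X + ∑ w ∈ t, f w) := by
  classical
  have hle : (∑ w ∈ t \ s, f w).degree ≤ g.degree :=
    (degree_sum_le _ _).trans (Finset.sup_le fun w hw => hs w (Finset.mem_sdiff.1 hw).2)
  rw [← Finset.sum_sdiff h, add_comm (∑ w ∈ t \ s, f w), ← add_assoc]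
  by_cases hg : g = 0
  · rw [hg, degree_zero, le_bot_iff, degree_eq_bot] at hle
    rw [hle, add_zero]
    exact LeadEq.rfl_nat _
  · refine ((LeadEq.rfl_nat _).add_right_of_degree_lt (hle.trans_lt ?_)).symm
    refine lt_of_lt_of_le ?_ (degree_le_degree_add_right _ _)
    rw [degree_mul, degree_X, degree_eq_natDegree hg]
    exact_mod_cast Nat.lt_succ_self _

theorem leadIntegral_linear : IsLinearIntegral leadIntegral where
  zero := ⟨0, ∅, by simp [LeadEq.zero], by simp, by simpa using LeadEq.zero⟩
  add := by
    rintro f f' a a' ⟨g, s, hc, hs, ha⟩ ⟨g', s', hc', hs', ha'⟩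
    classical
    refine ⟨g + g', s ∪ s', (hc.union hc').mono ?_, fun w hw => ?_, ?_⟩
    · intro w hw
      by_contra! h
      simp only [Set.mem_union, Set.mem_ofPred_eq, not_or, not_not] at h
      exact hw (h.1.add h.2)
    · rw [Finset.notMem_union] at hw
      refine (degree_add_le _ _).trans (max_le ?_ ?_)
      · exact (hs w hw.1).trans (degree_le_degree_add_right _ _)
      · exact (hs' w hw.2).trans (degree_le_degree_add_left _ _)
    · have h := (ha.trans (leadEq_add_sum_of_subset hs (t := s ∪ s') Finset.subset_union_left)).add
        (ha'.trans (leadEq_add_sum_of_subset hs' (t := s ∪ s') Finset.subset_union_right))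
      have e : (g + g') * X + ∑ w ∈ s ∪ s', (f w + f' w) =
          (g * X + ∑ w ∈ s ∪ s', f w) + (g' * X + ∑ w ∈ s ∪ s', f' w) := by
        rw [Finset.sum_add_distrib]
        ring
      rwa [e]
  mul := by
    rintro f a c ⟨g, s, hc, hs, ha⟩
    refine ⟨c * g, s, hc.mono fun w hw h => hw ((LeadEq.rfl_nat c).mul h), fun w hw => ?_, ?_⟩
    · simp only [degree_mul]
      gcongr
      exact hs w hw
    · have e : c * g * X + ∑ w ∈ s, c * f w = c * (g * X + ∑ w ∈ s, f w) := by
        rw [← Finset.mul_sum]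
        ring
      rw [e]
      exact (LeadEq.rfl_nat c).mul ha

/-- For positive `n` the integral is only determined up to its leading term. Over ℂ⁰ a polynomial
with the leading term of `1` or `0` is that constant. -/
theorem HasLead.congr : ∀ {n : ℕ} {V : Set (Fin n → ℂ)} {q q' : ℕ[X]}, HasLead V q →
    LeadEq q' q → HasLead V q'
  | 0, V, q, q', h, hq => by
    refine ⟨fun hV => ?_, fun hV => hq.eq_zero_iff.2 (h.2 hV)⟩
    rw [h.1 hV] at hq
    have h0 := hq.natDegree_eq
    rw [natDegree_one] at h0
    rw [eq_C_of_natDegree_eq_zero h0, ← h0, coeff_natDegree, hq.2]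
    simp
  | _ + 1, _, _, _, ⟨f, hf, g, s, hc, hs, ha⟩, hq => ⟨f, hf, g, s, hc, hs, hq.trans ha⟩

theorem exists_notMem_countable {M : Set ℂ} (hM : M.Countable) : ∃ w, w ∉ M := by
  by_contra! h
  exact not_countable_complex (hM.mono fun w _ => h w)

theorem HasLead.eq_zero_of_empty : ∀ {n : ℕ} {q : ℕ[X]}, HasLead (∅ : Set (Fin n → ℂ)) q → q = 0
  | 0, _, h => h.2 rfl
  | n + 1, q, ⟨f, hf, g, s, hc, _, ha⟩ => by
    have hf0 : ∀ w, f w = 0 := fun w => HasLead.eq_zero_of_empty (hf w)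
    obtain ⟨w, hw⟩ := exists_notMem_countable hc
    have hg : g = 0 := (LeadEq.eq_zero_iff (not_not.1 hw)).1 (hf0 w)
    refine ha.eq_zero_iff.2 ?_
    simp [hg, hf0]

/-- The exact integral differs from `g * X + ∑ w ∈ s, f w` by `s.card • g`, which is of lower degree
than `g * X` unless `g = 0`. -/
theorem HasCount.exists_hasLead : ∀ {n : ℕ} {V : Set (Fin n → ℂ)} {c : ℤ[X]}, HasCount V c →
    ∃ q, HasLead V q ∧ LeadEq c q
  | 0, V, c, h => by
    rcases V.eq_empty_or_nonempty with hV | hV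
    · exact ⟨0, ⟨by simp [hV], fun _ => rfl⟩, by rw [h.2 hV]; exact LeadEq.zero⟩
    · exact ⟨1, ⟨fun _ => rfl, fun h => (hV.ne_empty h).elim⟩, by rw [h.1 hV]; exact LeadEq.one⟩
  | n + 1, V, c, ⟨f, hf, g, s, hs, hc⟩ => by
    choose q hq hfq using fun w => HasCount.exists_hasLead (hf w)
    obtain ⟨w₀, hw₀⟩ := Infinite.exists_notMem_finset s
    have hg : LeadEq g (q w₀) := hs w₀ hw₀ ▸ hfq w₀
    have hle : ∀ w ∉ s, (q w).degree = (q w₀).degree := fun w hw => by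
      rw [← (hfq w).1, ← hg.1, hs w hw]
    refine ⟨q w₀ * Polynomial.X + ∑ w ∈ s, q w, ⟨q, hq, q w₀, s, ?_, fun w hw => (hle w hw).le,
      LeadEq.rfl_nat _⟩, ?_⟩
    · refine s.countable_toSet.mono fun w hw => ?_
      by_contra hws
      refine hw ⟨hle w hws, ?_⟩
      have := (hfq w).2
      rw [hs w hws, hg.2] at this
      exact_mod_cast this.symm
    · have h := (hg.mul (LeadEq.X (R := ℤ))).add (LeadEq.sum s fun w _ => hfq w)
      have e : c = (g * Polynomial.X + ∑ w ∈ s, f w) + -(s.card • g) := by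
        rw [hc, Finset.sum_sub_distrib, Finset.sum_const]
        ring
      by_cases h0 : g = 0
      · rw [e, h0, smul_zero, neg_zero, add_zero, ← h0]
        exact h
      · rw [e]
        refine h.add_right_of_degree_lt ?_
        rw [degree_neg, h.1]
        refine (degree_smul_le _ _).trans_lt (lt_of_lt_of_le ?_ (degree_le_degree_add_right _ _))
        have h0' : q w₀ ≠ 0 := fun h' => h0 (hg.eq_zero_iff.2 h')
        rw [degree_mul, degree_X, hg.1, degree_eq_natDegree h0']
        exact_mod_cast Nat.lt_succ_self _

/-- Both leading coefficients are natural numbers, so the leading terms do not cancel. -/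
theorem HasCount.degree_le_union {n : ℕ} {V W : Set (Fin n → ℂ)} {c d : ℤ[X]} (hV : HasCount V c)
    (hW : HasCount W d) (h : Disjoint V W) :
    HasCount (V ∪ W) (c + d) ∧ (c + d).degree = max c.degree d.degree := by
  refine ⟨IsIterated.union countIntegral_linear h hV hW, ?_⟩
  obtain ⟨p, -, hp⟩ := hV.exists_hasLead
  obtain ⟨q, -, hq⟩ := hW.exists_hasLead
  rw [(hp.add hq).1, hp.1, hq.1]
  exact le_antisymm (degree_add_le _ _)
    (max_le (degree_le_degree_add_right _ _) (degree_le_degree_add_left _ _))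

theorem IsAlgCounting.exists_hasLead {n : ℕ} {V : Set (Fin n → ℂ)} {p : CountingRing}
    (h : IsAlgCounting V p) : ∃ q, HasLead V q ∧ LeadEq p q := by
  induction h with
  | constructible V c hV hc =>
    obtain ⟨q, hq, hcq⟩ := hc.hasCount.exists_hasLead
    have hinj : Function.Injective (C : ℤ →+* ℤ[X]) := C_injective
    refine ⟨q, hq, ?_, ?_⟩
    · rw [← hcq.1]
      exact degree_map_eq_of_injective hinj c
    · have : (inclusion c).leadingCoeff = C c.leadingCoeff := leadingCoeff_map_of_injective hinj c
      rw [this, hcq.2]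
      simp
  | cocountable M hM hM' =>
    classical
    -- The slice over `w` is a point for all but countably many `w`: the generic value is `1`, no
    -- finite exceptional set is needed, and the integral is `X`.
    refine ⟨X, ⟨fun w => if (fun _ => w) ∈ M then 0 else 1, fun w => ?_,
      1, ∅, ?_, fun w _ => ?_, by simpa using LeadEq.rfl_nat X⟩, ?_⟩
    · beta_reduce
      have e : ∀ u : Fin 0 → ℂ, (Fin.cons w u : Fin 1 → ℂ) = fun _ => w := by
        intro u
        ext j
        rw [Fin.fin_one_eq_zero j, Fin.cons_zero]
      split_ifs with hw
      · refine ⟨?_, fun _ => rfl⟩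
        rintro ⟨u, hu⟩
        rw [mem_slice, e] at hu
        exact (hu hw).elim
      · refine ⟨fun _ => rfl, fun h => ?_⟩
        have : (Fin.elim0 : Fin 0 → ℂ) ∈ slice w Mᶜ := by
          rw [mem_slice, e]
          exact hw
        simp [h] at this
    · refine (hM.image fun v : Fin 1 → ℂ => v 0).mono fun w hw => ?_
      refine ⟨fun _ => w, ?_, rfl⟩
      by_contra hM
      exact hw (by simpa only [if_neg hM] using LeadEq.one)
    · beta_reduce
      split_ifs <;> simp
    · have e : infty - aleph = (X + C (-X) : CountingRing) := by
        rw [C_neg, ← sub_eq_add_neg]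
        rfl
      rw [e]
      exact ⟨by rw [degree_X_add_C, degree_X], by rw [leadingCoeff_X_add_C]; simp⟩
  | union V W c d h _ _ ihc ihd =>
    obtain ⟨q, hq, hcq⟩ := ihc
    obtain ⟨r, hr, hdr⟩ := ihd
    exact ⟨q + r, IsIterated.union leadIntegral_linear h hq hr, hcq.add hdr⟩
  | @fibration m k hm V c d hc _ ihc ihd =>
    obtain ⟨r, hr, hdr⟩ := ihd
    rcases (proj m k '' V).eq_empty_or_nonempty with h0 | ⟨w₀, hw₀⟩
    · rw [h0] at hr
      rw [hdr.eq_zero_iff.2 hr.eq_zero_of_empty, mul_zero, Set.image_eq_empty.1 h0]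
      exact ⟨0, IsIterated.empty leadIntegral_linear _, LeadEq.zero⟩
    · obtain ⟨q, -, hcq⟩ := ihc w₀ hw₀
      refine ⟨q * r, IsIterated.fibration leadIntegral_linear hr fun w hw => ?_, hcq.mul hdr⟩
      -- The fibers may come with different polynomials `q'`, but all have the leading term of `c`,
      -- so the `q` of one fiber serves for all.
      obtain ⟨q', hq', hcq'⟩ := ihc w hw
      refine hq'.congr ⟨hcq.1.symm.trans hcq'.1, ?_⟩
      have := hcq.2.symm.trans hcq'.2
      exact_mod_cast this

end CountingPoly

namespace CountingPoly

open Polynomial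

/-! ### Bounds for the leading term -/

/-- The values of the `i`-th coordinate of the points of `V` that agree with `a` in the coordinates
below `i`. -/
def nextValues {n : ℕ} (V : Set (Fin n → ℂ)) (a : Fin n → ℂ) (i : Fin n) : Set ℂ :=
  {t | ∃ b ∈ V, (∀ j < i, b j = a j) ∧ b i = t}

theorem nextValues_slice {n : ℕ} (V : Set (Fin (n + 1) → ℂ)) (w : ℂ) (u : Fin n → ℂ) (i : Fin n) :
    nextValues (slice w V) u i = nextValues V (Fin.cons w u) i.succ := by
  ext t
  constructor
  · rintro ⟨b, hb, hba, hbt⟩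
    refine ⟨Fin.cons w b, hb, fun j hj => ?_, by simpa using hbt⟩
    revert hj
    refine Fin.cases (fun _ => by simp) (fun j hj => ?_) j
    simpa using hba j (Fin.succ_lt_succ_iff.1 hj)
  · rintro ⟨b, hb, hba, hbt⟩
    have h0 : b 0 = w := by simpa using hba 0 (Fin.succ_pos i)
    refine ⟨Fin.tail b, ?_, fun j hj => ?_, hbt⟩
    · rwa [mem_slice, ← h0, Fin.cons_self_tail]
    · exact (hba j.succ (Fin.succ_lt_succ_iff.2 hj)).trans (Fin.cons_succ (α := fun _ => ℂ) w u j)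

theorem mem_nextValues_zero {n : ℕ} {V : Set (Fin (n + 1) → ℂ)} {a : Fin (n + 1) → ℂ} {t : ℂ} :
    t ∈ nextValues V a 0 ↔ (slice t V).Nonempty := by
  constructor
  · rintro ⟨b, hb, -, rfl⟩
    exact ⟨Fin.tail b, by rwa [mem_slice, Fin.cons_self_tail]⟩
  · rintro ⟨u, hu⟩
    exact ⟨_, hu, fun j hj => (Fin.not_lt_zero j hj).elim, by simp⟩

/-- The number of indices `i` with `D i = 0`. -/
def freeCount {n : ℕ} (D : Fin n → ℕ) : ℕ := ∑ i, if D i = 0 then 1 else 0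

/-- The product of the nonzero `D i`. -/
def sheetCount {n : ℕ} (D : Fin n → ℕ) : ℕ := ∏ i, if D i = 0 then 1 else D i

theorem freeCount_succ {n : ℕ} (D : Fin (n + 1) → ℕ) :
    freeCount D = (if D 0 = 0 then 1 else 0) + freeCount (Fin.tail D) := Fin.sum_univ_succ _

theorem sheetCount_succ {n : ℕ} (D : Fin (n + 1) → ℕ) :
    sheetCount D = (if D 0 = 0 then 1 else D 0) * sheetCount (Fin.tail D) := Fin.prod_univ_succ _

theorem sheetCount_pos {n : ℕ} (D : Fin n → ℕ) : 0 < sheetCount D :=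
  Finset.prod_pos fun i _ => by split_ifs <;> omega

/-- The leading term of `q` is at most `N * X ^ d`. -/
def LeadAtMost (q : ℕ[X]) (d N : ℕ) : Prop := q.natDegree ≤ d ∧ q.coeff d ≤ N

/-- The leading term of `q` is at least `N * X ^ d`. -/
def LeadAtLeast (q : ℕ[X]) (d N : ℕ) : Prop := d < q.natDegree ∨ N ≤ q.coeff d

theorem LeadEq.leadAtMost {q q' : ℕ[X]} (h : LeadEq q q') {d N : ℕ} (hq : LeadAtMost q d N) :
    LeadAtMost q' d N :=
  ⟨h.natDegree_eq ▸ hq.1, h.coeff_eq hq.1 ▸ hq.2⟩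

theorem LeadEq.leadAtLeast {q q' : ℕ[X]} (h : LeadEq q q') {d N : ℕ} (hq : LeadAtLeast q d N) :
    LeadAtLeast q' d N := by
  rcases lt_or_ge d q.natDegree with hd | hd
  · exact Or.inl (h.natDegree_eq ▸ hd)
  · exact Or.inr (h.coeff_eq hd ▸ hq.resolve_left hd.not_gt)

theorem LeadAtLeast.mono {q q' : ℕ[X]} (h : ∀ j, q.coeff j ≤ q'.coeff j) {d N : ℕ}
    (hq : LeadAtLeast q d N) : LeadAtLeast q' d N :=
  hq.imp (fun hd => hd.trans_le (natDegree_le_natDegree (degree_le_of_coeff_le h)))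
    fun hd => hd.trans (h d)

/-- A coordinate with `D i ≠ 0` multiplies the leading coefficient by at most `D i`; any other
raises the degree by at most one. -/
theorem HasLead.leadAtMost : ∀ {n : ℕ} {V : Set (Fin n → ℂ)} {q : ℕ[X]} (D : Fin n → ℕ),
    HasLead V q → (∀ i, D i ≠ 0 → ∀ a ∈ V, (nextValues V a i).encard ≤ D i) →
    LeadAtMost q (freeCount D) (sheetCount D)
  | 0, V, q, D, h, _ => by
    rcases V.eq_empty_or_nonempty with hV | hV
    · simp [h.2 hV, LeadAtMost]
    · simp [h.1 hV, LeadAtMost, freeCount, sheetCount]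
  | n + 1, V, q, D, ⟨f, hf, g, s, hc, hs, ha⟩, hD => by
    have ih : ∀ w, LeadAtMost (f w) (freeCount (Fin.tail D)) (sheetCount (Fin.tail D)) :=
      fun w => HasLead.leadAtMost (Fin.tail D) (hf w) fun i hi u hu => by
        rw [nextValues_slice]
        exact hD i.succ hi _ hu
    rw [freeCount_succ, sheetCount_succ]
    refine ha.symm.leadAtMost ?_
    split_ifs with h0
    · obtain ⟨w, hw⟩ := exists_notMem_countable hc
      have hg := LeadEq.leadAtMost (not_not.1 hw) (ih w)
      refine ⟨natDegree_add_le_of_degree_le ?_ (natDegree_sum_le_of_forall_le _ _ fun w _ => ?_), ?_⟩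
      · refine natDegree_mul_le.trans ?_
        rw [natDegree_X, add_comm]
        exact Nat.add_le_add_left hg.1 1
      · exact (ih w).1.trans (Nat.le_add_left _ _)
      -- The finitely many exceptional terms have too small a degree to contribute to this
      -- coefficient.
      · rw [coeff_add, finsetSum_coeff, add_comm 1, coeff_mul_X, Finset.sum_eq_zero, add_zero,
          one_mul]
        · exact hg.2
        · exact fun w _ => coeff_eq_zero_of_natDegree_lt (Nat.lt_succ_of_le (ih w).1)
    · rw [zero_add]
      have hT : ∃ T : Finset ℂ, T.card ≤ D 0 ∧ ∀ w ∉ T, f w = 0 := by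
        rcases V.eq_empty_or_nonempty with rfl | ⟨a, hV⟩
        · exact ⟨∅, by simp, fun w _ => HasLead.eq_zero_of_empty (hf w)⟩
        · have hle := hD 0 h0 a hV
          have hfin : (nextValues V a 0).Finite := Set.finite_of_encard_le_coe hle
          refine ⟨hfin.toFinset, ?_, fun w hw => ?_⟩
          · rw [hfin.encard_eq_coe_toFinset_card] at hle
            exact_mod_cast hle
          · rw [Set.Finite.mem_toFinset, mem_nextValues_zero, Set.not_nonempty_iff_eq_empty] at hw
            have := hf w
            rw [hw] at this
            exact HasLead.eq_zero_of_empty this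
      obtain ⟨T, hTc, hT⟩ := hT
      -- At a generic `w` outside `T` the slice has value zero, which forces `g = 0`.
      obtain ⟨w, hw⟩ := exists_notMem_countable (hc.union T.countable_toSet)
      simp only [Set.mem_union, Set.mem_ofPred_eq, not_or, not_not, Finset.mem_coe] at hw
      have hg : g = 0 := hw.1.eq_zero_iff.1 (hT w hw.2)
      rw [hg, zero_mul, zero_add]
      refine ⟨natDegree_sum_le_of_forall_le _ _ fun w _ => (ih w).1, ?_⟩
      rw [finsetSum_coeff]
      classical
      calc ∑ w ∈ s, (f w).coeff (freeCount (Fin.tail D))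
          ≤ ∑ w ∈ s ∪ T, (f w).coeff (freeCount (Fin.tail D)) :=
            Finset.sum_le_sum_of_subset Finset.subset_union_left
        _ = ∑ w ∈ T, (f w).coeff (freeCount (Fin.tail D)) :=
            (Finset.sum_subset Finset.subset_union_right fun w _ hw => by simp [hT w hw]).symm
        _ ≤ T.card • sheetCount (Fin.tail D) := Finset.sum_le_card_nsmul _ _ _ fun w _ => (ih w).2
        _ ≤ D 0 * sheetCount (Fin.tail D) := by
            rw [smul_eq_mul]
            exact Nat.mul_le_mul_right _ hTc

/-- The next values are only controlled on the subset `A`. This allows `V` to be the Zariski closure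
of `A`. -/
theorem HasLead.leadAtLeast : ∀ {n : ℕ} {A V : Set (Fin n → ℂ)} {q : ℕ[X]} (D : Fin n → ℕ),
    HasLead V q → A ⊆ V → A.Nonempty →
    (∀ i, D i = 0 → ∀ a ∈ A, (nextValues A a i)ᶜ.Countable) →
    (∀ i, D i ≠ 0 → ∀ a ∈ A, (D i : ℕ∞) ≤ (nextValues A a i).encard) →
    LeadAtLeast q (freeCount D) (sheetCount D)
  | 0, A, V, q, D, h, hAV, hA, _, _ => by
    simp [h.1 (hA.mono hAV), LeadAtLeast, freeCount, sheetCount]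
  | n + 1, A, V, q, D, ⟨f, hf, g, s, hc, hs, ha⟩, hAV, ⟨a, haA⟩, hD, hD' => by
    have ih : ∀ w, (slice w A).Nonempty →
        LeadAtLeast (f w) (freeCount (Fin.tail D)) (sheetCount (Fin.tail D)) :=
      fun w hw => HasLead.leadAtLeast (A := slice w A) (Fin.tail D) (hf w) (fun u hu => hAV hu) hw
        (fun i hi u hu => by
          rw [nextValues_slice]
          exact hD i.succ hi _ hu)
        (fun i hi u hu => by
          rw [nextValues_slice]
          exact hD' i.succ hi _ hu)
    rw [freeCount_succ, sheetCount_succ]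
    split_ifs with h0
    · obtain ⟨w, hw⟩ := exists_notMem_countable (hc.union (hD 0 h0 a haA))
      simp only [Set.mem_union, Set.mem_ofPred_eq, not_or, not_not, Set.mem_compl_iff] at hw
      have hg := hw.1.leadAtLeast (ih w (mem_nextValues_zero.1 hw.2))
      refine ha.symm.leadAtLeast (LeadAtLeast.mono (q := g * X)
        (fun j => by rw [coeff_add]; exact Nat.le_add_right _ _) ?_)
      rw [one_mul, add_comm 1]
      refine hg.imp (fun h => ?_) fun h => by rwa [coeff_mul_X]
      have hg0 : g ≠ 0 := by
        rintro rfl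
        simp at h
      rw [natDegree_mul_X hg0]
      exact Nat.succ_lt_succ h
    · rw [zero_add]
      classical
      obtain ⟨T', hT', hcard⟩ := Set.exists_subset_encard_eq (hD' 0 h0 a haA)
      have hfin : T'.Finite := Set.finite_of_encard_eq_coe hcard
      lift T' to Finset ℂ using hfin
      rw [Set.encard_coe_eq_coe_finsetCard, Nat.cast_inj] at hcard
      have hT : ∀ w ∈ T', LeadAtLeast (f w) (freeCount (Fin.tail D)) (sheetCount (Fin.tail D)) :=
        fun w hw => ih w (mem_nextValues_zero.1 (hT' hw))
      refine (ha.trans (leadEq_add_sum_of_subset hs (t := s ∪ T')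
        Finset.subset_union_left)).symm.leadAtLeast (LeadAtLeast.mono (q := ∑ w ∈ T', f w)
        (fun j => ?_) ?_)
      · rw [coeff_add, finsetSum_coeff, finsetSum_coeff]
        exact (Finset.sum_le_sum_of_subset Finset.subset_union_right).trans (Nat.le_add_left _ _)
      -- One term of larger degree settles the claim, as nothing cancels. Otherwise each of the `D
      -- 0` terms contributes at least `sheetCount (Fin.tail D)`.
      · by_cases hdeg : ∃ w ∈ T', freeCount (Fin.tail D) < (f w).natDegree
        · obtain ⟨w, hw, hd⟩ := hdeg
          refine Or.inl (hd.trans_le (natDegree_le_natDegree (degree_le_of_coeff_le fun j => ?_)))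
          rw [finsetSum_coeff]
          exact Finset.single_le_sum (f := fun w => (f w).coeff j) (fun _ _ => Nat.zero_le _) hw
        · push Not at hdeg
          refine Or.inr ?_
          rw [finsetSum_coeff, ← hcard, ← smul_eq_mul]
          exact Finset.card_nsmul_le_sum _ _ _ fun w hw => (hT w hw).resolve_left (hdeg w hw).not_gt

theorem LeadAtMost.eq_of_leadAtLeast {q : ℕ[X]} {d N : ℕ} (hN : 0 < N) (h : LeadAtMost q d N)
    (h' : LeadAtLeast q d N) : LeadEq q (C N * X ^ d) := by
  have hc : q.coeff d = N := le_antisymm h.2 (h'.resolve_left h.1.not_gt)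
  have hd : q.natDegree = d := le_antisymm h.1 (le_natDegree_of_ne_zero (by omega))
  have hq : q ≠ 0 := by
    rintro rfl
    simp at hc
    omega
  refine ⟨?_, ?_⟩
  · rw [degree_C_mul_X_pow _ hN.ne', degree_eq_natDegree hq, hd]
  · rw [leadingCoeff_C_mul_X_pow, leadingCoeff, hd, hc]
    simp

end CountingPoly

namespace CountingPoly

open Polynomial

/-! ### Constructible sets and functions -/

namespace IsConstructible

variable {n : ℕ} {V W : Set (Fin n → ℂ)}

theorem zeroSet (p : MvPolynomial (Fin n) ℂ) : IsConstructible {a | MvPolynomial.eval a p = 0} :=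
  BooleanSubalgebra.mem_closure_of_mem ⟨p, rfl⟩

theorem compl (hV : IsConstructible V) : IsConstructible Vᶜ := BooleanSubalgebra.compl_mem hV

theorem union (hV : IsConstructible V) (hW : IsConstructible W) : IsConstructible (V ∪ W) :=
  BooleanSubalgebra.sup_mem hV hW

theorem inter (hV : IsConstructible V) (hW : IsConstructible W) : IsConstructible (V ∩ W) :=
  BooleanSubalgebra.inf_mem hV hW

theorem diff (hV : IsConstructible V) (hW : IsConstructible W) : IsConstructible (V \ W) :=
  BooleanSubalgebra.sdiff_mem hV hW

theorem empty : IsConstructible (∅ : Set (Fin n → ℂ)) := BooleanSubalgebra.bot_mem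

theorem univ : IsConstructible (Set.univ : Set (Fin n → ℂ)) := BooleanSubalgebra.top_mem

theorem biUnion {ι : Type*} {s : Set ι} (hs : s.Finite) {f : ι → Set (Fin n → ℂ)}
    (h : ∀ i ∈ s, IsConstructible (f i)) : IsConstructible (⋃ i ∈ s, f i) := by
  induction s, hs using Set.Finite.induction_on with
  | empty => simpa using empty
  | insert _ _ ih =>
    rw [Set.biUnion_insert]
    exact (h _ (Set.mem_insert _ _)).union (ih fun i hi => h i (Set.mem_insert_of_mem _ hi))

theorem biInter {ι : Type*} {s : Set ι} (hs : s.Finite) {f : ι → Set (Fin n → ℂ)}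
    (h : ∀ i ∈ s, IsConstructible (f i)) : IsConstructible (⋂ i ∈ s, f i) := by
  rw [← compl_compl (⋂ i ∈ s, f i), Set.compl_iInter₂]
  exact (biUnion hs fun i hi => (h i hi).compl).compl

/-- Induction over constructible sets. -/
theorem induction {P : Set (Fin n → ℂ) → Prop}
    (zeroSet : ∀ p : MvPolynomial (Fin n) ℂ, P {a | MvPolynomial.eval a p = 0})
    (union : ∀ V W, P V → P W → P (V ∪ W)) (compl : ∀ V, P V → P Vᶜ)
    (hV : IsConstructible V) : P V := by
  refine BooleanSubalgebra.closure_bot_sup_induction (p := fun x _ => P x) ?_ ?_ ?_ ?_ hV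
  · rintro x ⟨p, rfl⟩
    exact zeroSet p
  · have : ({a | MvPolynomial.eval a (1 : MvPolynomial (Fin n) ℂ) = 0} : Set (Fin n → ℂ)) = ⊥ := by
      ext
      simp
    exact this ▸ zeroSet 1
  · exact fun x _ y _ hx hy => union x y hx hy
  · exact fun x _ hx => compl x hx

theorem preimage {m : ℕ} (hV : IsConstructible V) (φ : (Fin m → ℂ) → Fin n → ℂ)
    (P : Fin n → MvPolynomial (Fin m) ℂ) (hφ : ∀ x j, φ x j = MvPolynomial.eval x (P j)) :
    IsConstructible (φ ⁻¹' V) := by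
  refine induction (P := fun V => IsConstructible (φ ⁻¹' V)) (fun p => ?_) (fun _ _ => union)
    (fun _ => compl) hV
  convert! zeroSet (MvPolynomial.bind₁ P p) using 1
  ext x
  have h : MvPolynomial.eval x (MvPolynomial.bind₁ P p) = MvPolynomial.eval (φ x) p := by
    rw [funext (hφ x)]
    exact MvPolynomial.eval₂Hom_bind₁ (RingHom.id ℂ) x P p
  simp only [Set.mem_preimage, Set.mem_ofPred_eq, h]

theorem preimage_proj {m k : ℕ} {V : Set (Fin m → ℂ)} (hV : IsConstructible V) :
    IsConstructible (proj m k ⁻¹' V) :=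
  hV.preimage _ (fun j => MvPolynomial.X (Fin.castAdd k j)) fun x j => by simp [proj]

theorem _root_.CountingPoly.isConstructible_fiber {m k : ℕ} {V : Set (Fin (m + k) → ℂ)} (hV : IsConstructible V) (w : Fin m → ℂ) :
    IsConstructible (fiber V w) := by
  refine hV.preimage (fun u => Fin.append w u)
    (Fin.append (fun j => MvPolynomial.C (w j)) MvPolynomial.X) fun x j => ?_
  refine Fin.addCases (fun j => ?_) (fun j => ?_) j <;> simp

end IsConstructible

/-- `F` has finitely many values, each on a constructible set. -/
structure IsConstructibleFun {m : ℕ} {α : Type*} (F : (Fin m → ℂ) → α) : Prop where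
  finite_range : (Set.range F).Finite
  preimage : ∀ c, IsConstructible (F ⁻¹' {c})

namespace IsConstructibleFun

variable {m : ℕ} {α β γ : Type*} {F : (Fin m → ℂ) → α} {G : (Fin m → ℂ) → β}

theorem const (a : α) : IsConstructibleFun fun _ : Fin m → ℂ => a where
  finite_range := Set.finite_range_const
  preimage c := by
    by_cases h : a = c
    · simpa [h] using IsConstructible.univ
    · have : (fun _ : Fin m → ℂ => a) ⁻¹' {c} = ∅ := Set.eq_empty_of_forall_notMem fun _ => h
      rw [this]
      exact IsConstructible.empty

theorem comp (h : α → β) (hF : IsConstructibleFun F) : IsConstructibleFun fun w => h (F w) where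
  finite_range := by
    have := hF.finite_range.image h
    rwa [← Set.range_comp] at this
  preimage c := by
    have : (fun w => h (F w)) ⁻¹' {c} = ⋃ a ∈ Set.range F ∩ h ⁻¹' {c}, F ⁻¹' {a} := by
      ext w
      simp
    rw [this]
    exact IsConstructible.biUnion (hF.finite_range.subset Set.inter_subset_left)
      fun a _ => hF.preimage a

theorem prodMk (hF : IsConstructibleFun F) (hG : IsConstructibleFun G) :
    IsConstructibleFun fun w => (F w, G w) where
  finite_range := (hF.finite_range.prod hG.finite_range).subset <| by
    rintro _ ⟨w, rfl⟩
    exact ⟨⟨w, rfl⟩, ⟨w, rfl⟩⟩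
  preimage c := by
    convert! (hF.preimage c.1).inter (hG.preimage c.2) using 1
    ext w
    simp [Prod.ext_iff]

theorem map₂ (h : α → β → γ) (hF : IsConstructibleFun F) (hG : IsConstructibleFun G) :
    IsConstructibleFun fun w => h (F w) (G w) :=
  (hF.prodMk hG).comp fun x => h x.1 x.2

theorem piecewise {F' : (Fin m → ℂ) → α} {H : (Fin m → ℂ) → α} {Z : Set (Fin m → ℂ)}
    (hZ : IsConstructible Z) (hF : IsConstructibleFun F) (hF' : IsConstructibleFun F')
    (h : ∀ w ∈ Z, H w = F w) (h' : ∀ w ∉ Z, H w = F' w) : IsConstructibleFun H where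
  finite_range := (hF.finite_range.union hF'.finite_range).subset <| by
    rintro _ ⟨w, rfl⟩
    by_cases hw : w ∈ Z
    · exact Or.inl ⟨w, (h w hw).symm⟩
    · exact Or.inr ⟨w, (h' w hw).symm⟩
  preimage c := by
    convert! (hZ.inter (hF.preimage c)).union (hZ.compl.inter (hF'.preimage c)) using 1
    ext w
    by_cases hw : w ∈ Z <;> simp [hw, h, h']

end IsConstructibleFun

/-! ### Counting the zeros of a polynomial with parameters -/

/-- The degree of a generator of an ideal of `ℂ[X]`. -/
noncomputable def generatorDegree (I : Ideal ℂ[X]) : ℕ :=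
  (Submodule.IsPrincipal.generator I).natDegree

/-- The degree of a greatest common divisor of `f` and `g`. -/
noncomputable def gcdDegree (f g : ℂ[X]) : ℕ := generatorDegree (Ideal.span {f, g})

theorem gcdDegree_comm (f g : ℂ[X]) : gcdDegree f g = gcdDegree g f := by
  rw [gcdDegree, gcdDegree, Set.pair_comm]

theorem gcdDegree_zero (f : ℂ[X]) : gcdDegree f 0 = f.natDegree := by
  rw [gcdDegree, Ideal.span_pair_zero]
  exact natDegree_eq_natDegree (degree_eq_degree_of_associated
    (Submodule.IsPrincipal.associated_generator_span_self f))

/-- A step of pseudo-division leaves the ideal generated by the pair unchanged. -/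
theorem gcdDegree_mul_sub {c : ℂ[X]} (hc : IsUnit c) (b f g : ℂ[X]) :
    gcdDegree (c * f - b * g) g = gcdDegree f g := by
  have : Ideal.span {c * f - b * g, g} = Ideal.span {f, g} := by
    obtain ⟨c, rfl⟩ := hc
    apply le_antisymm <;> rw [Ideal.span_le] <;> rintro x (rfl | rfl) <;>
      rw [SetLike.mem_coe, Ideal.mem_span_pair]
    · exact ⟨c, -b, by ring⟩
    · exact ⟨0, 1, by ring⟩
    · refine ⟨↑c⁻¹, ↑c⁻¹ * b, ?_⟩
      have := c.inv_mul
      linear_combination x * this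
    · exact ⟨0, 1, by ring⟩
  rw [gcdDegree, gcdDegree, this]

/-- In characteristic zero the derivative loses one multiplicity at `t`. Divisibility bounds the
multiplicity of the gcd from above, the Bézout relation from below. -/
theorem rootMultiplicity_generator {f : ℂ[X]} (hf : f ≠ 0) {t : ℂ} (ht : f.IsRoot t) :
    (Submodule.IsPrincipal.generator (Ideal.span {f, derivative f})).rootMultiplicity t + 1 =
      f.rootMultiplicity t := by
  set g := Submodule.IsPrincipal.generator (Ideal.span {f, derivative f}) with hg
  have hgf : g ∣ f := (Submodule.IsPrincipal.mem_iff_generator_dvd _).1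
    (Ideal.subset_span (Set.mem_insert _ _))
  have hgf' : g ∣ derivative f := (Submodule.IsPrincipal.mem_iff_generator_dvd _).1
    (Ideal.subset_span (Set.mem_insert_of_mem _ rfl))
  have hg0 : g ≠ 0 := fun h => hf (zero_dvd_iff.1 (h ▸ hgf))
  have hpos : 0 < f.rootMultiplicity t := (rootMultiplicity_pos hf).2 ht
  have hd := derivative_rootMultiplicity_of_root ht
  have hd0 : derivative f ≠ 0 := fun h => by
    have h0 := derivative_eq_zero.1 h
    rw [eq_C_of_natDegree_eq_zero h0] at ht hf
    simp_all
  have h1 : g.rootMultiplicity t ≤ f.rootMultiplicity t - 1 := by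
    rw [← hd]
    exact rootMultiplicity_le_rootMultiplicity_of_dvd hd0 hgf' t
  have h2 : f.rootMultiplicity t - 1 ≤ g.rootMultiplicity t := by
    rw [le_rootMultiplicity_iff hg0]
    obtain ⟨a, b, hab⟩ := Ideal.mem_span_pair.1
      (Submodule.IsPrincipal.generator_mem (Ideal.span {f, derivative f}))
    rw [hg, ← hab]
    refine dvd_add (Dvd.dvd.mul_left ?_ _) (Dvd.dvd.mul_left ?_ _)
    · exact (pow_dvd_pow _ (Nat.sub_le _ _)).trans (pow_rootMultiplicity_dvd f t)
    · rw [← hd]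
      exact pow_rootMultiplicity_dvd _ t
  omega

/-- The gcd with the derivative loses exactly one at every root. Distinct zeros are thus counted by
degrees, which vary constructibly with parameters. -/
theorem card_roots_add_gcdDegree {f : ℂ[X]} (hf : f ≠ 0) :
    f.roots.toFinset.card + gcdDegree f (derivative f) = f.natDegree := by
  set g := Submodule.IsPrincipal.generator (Ideal.span {f, derivative f}) with hg
  have hgf : g ∣ f := (Submodule.IsPrincipal.mem_iff_generator_dvd _).1
    (Ideal.subset_span (Set.mem_insert _ _))
  have hg0 : g ≠ 0 := fun h => hf (zero_dvd_iff.1 (h ▸ hgf))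
  have key : ∀ h : ℂ[X], (∀ t, h.IsRoot t → f.IsRoot t) → h ≠ 0 →
      h.natDegree = ∑ t ∈ f.roots.toFinset, h.rootMultiplicity t := by
    intro h hh h0
    rw [(IsAlgClosed.splits h).natDegree_eq_card_roots, ← Multiset.toFinset_sum_count_eq]
    simp only [count_roots]
    refine Finset.sum_subset (fun t ht => ?_) fun t _ ht => ?_
    · rw [Multiset.mem_toFinset, mem_roots h0] at ht
      rw [Multiset.mem_toFinset, mem_roots hf]
      exact hh t ht
    · rw [Multiset.mem_toFinset, mem_roots h0] at ht
      exact rootMultiplicity_eq_zero ht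
  rw [gcdDegree, generatorDegree, ← hg, key f (fun _ => id) hf, key g (fun t ht => ht.dvd hgf) hg0,
    Finset.card_eq_sum_ones, ← Finset.sum_add_distrib]
  refine Finset.sum_congr rfl fun t ht => ?_
  rw [Multiset.mem_toFinset, mem_roots hf] at ht
  rw [add_comm]
  exact rootMultiplicity_generator hf ht

section Parameters

variable {m : ℕ}

/-- The specialization of the parameters to `w`. -/
noncomputable abbrev evalParam (w : Fin m → ℂ) (p : (MvPolynomial (Fin m) ℂ)[X]) : ℂ[X] :=
  p.map (MvPolynomial.eval w)

theorem evalParam_eraseLead {w : Fin m → ℂ} {p : (MvPolynomial (Fin m) ℂ)[X]}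
    (h : MvPolynomial.eval w p.leadingCoeff = 0) : evalParam w p = evalParam w p.eraseLead := by
  have := congrArg (evalParam w) p.eraseLead_add_C_mul_X_pow
  rw [← this, evalParam, Polynomial.map_add, Polynomial.map_mul, map_C, h, C_0, zero_mul, add_zero]

theorem isConstructibleFun_natDegree (p : (MvPolynomial (Fin m) ℂ)[X]) :
    IsConstructibleFun fun w => (evalParam w p).natDegree := by
  induction hd : p.degree using WellFoundedLT.induction generalizing p with
  | ind d ih =>
    by_cases hp : p = 0
    · simpa [hp] using IsConstructibleFun.const 0
    · refine IsConstructibleFun.piecewise (IsConstructible.zeroSet p.leadingCoeff)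
        (ih _ (hd ▸ degree_eraseLead_lt hp) p.eraseLead rfl)
        (IsConstructibleFun.const p.natDegree) (fun w hw => ?_) fun w hw => ?_
      · exact congrArg natDegree (evalParam_eraseLead hw)
      · exact natDegree_map_of_leadingCoeff_ne_zero _ hw

/-- Euclid's algorithm with parameters, for `q.degree ≤ p.degree` and then by symmetry. Where the
leading coefficient of `q` vanishes it is erased; elsewhere it is used to cancel the leading term of
`p`. Either way the pair of degrees drops in the product order. -/
theorem isConstructibleFun_gcdDegree (p q : (MvPolynomial (Fin m) ℂ)[X]) :
    IsConstructibleFun fun w => gcdDegree (evalParam w p) (evalParam w q) := by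
  induction hd : (p.degree, q.degree) using
    (inferInstance : WellFoundedLT (WithBot ℕ × WithBot ℕ)).induction generalizing p q with
  | ind d ih =>
    subst hd
    have key : ∀ p q : (MvPolynomial (Fin m) ℂ)[X], q ≠ 0 → q.degree ≤ p.degree →
        (∀ p', p'.degree < p.degree →
          IsConstructibleFun fun w => gcdDegree (evalParam w p') (evalParam w q)) →
        (∀ q', q'.degree < q.degree →
          IsConstructibleFun fun w => gcdDegree (evalParam w p) (evalParam w q')) →
        IsConstructibleFun fun w => gcdDegree (evalParam w p) (evalParam w q) := by
      intro p q hq hle ih₁ ih₂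
      have hp : p ≠ 0 := by
        rintro rfl
        rw [degree_zero, le_bot_iff, degree_eq_bot] at hle
        exact hq hle
      have hle' : q.natDegree ≤ p.natDegree := natDegree_le_natDegree hle
      set b := C p.leadingCoeff * X ^ (p.natDegree - q.natDegree) with hb
      have hlq := leadingCoeff_ne_zero.2 hq
      have hlp := leadingCoeff_ne_zero.2 hp
      have hlt : (C q.leadingCoeff * p - b * q).degree < p.degree := by
        have e : (C q.leadingCoeff * p).degree = p.degree := by
          rw [degree_mul, degree_C hlq, zero_add]
        have e' : (b * q).degree = p.degree := by
          rw [degree_mul, hb, degree_C_mul_X_pow _ hlp, degree_eq_natDegree hq,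
            degree_eq_natDegree hp]
          exact_mod_cast Nat.sub_add_cancel hle'
        refine lt_of_lt_of_eq (degree_sub_lt_left (e.trans e'.symm) (mul_ne_zero (C_ne_zero.2 hlq) hp)
          ?_) e
        rw [leadingCoeff_mul, leadingCoeff_mul, hb, leadingCoeff_C_mul_X_pow, leadingCoeff_C]
        ring
      refine IsConstructibleFun.piecewise (IsConstructible.zeroSet q.leadingCoeff)
        (ih₂ q.eraseLead (degree_eraseLead_lt hq)) (ih₁ _ hlt) (fun w hw => ?_) fun w hw => ?_
      · rw [evalParam_eraseLead hw]
      · have hu : IsUnit (C (MvPolynomial.eval w q.leadingCoeff)) :=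
          isUnit_C.2 (isUnit_iff_ne_zero.2 hw)
        rw [← gcdDegree_mul_sub hu (evalParam w b)]
        simp [evalParam]
    by_cases hq : q = 0
    · simpa [hq, gcdDegree_zero] using isConstructibleFun_natDegree p
    by_cases hp : p = 0
    · simpa [hp, gcdDegree_comm 0, gcdDegree_zero] using isConstructibleFun_natDegree q
    rcases le_total q.degree p.degree with h | h
    · exact key p q hq h (fun p' hp' => ih _ (Prod.mk_lt_mk_iff_left.2 hp') p' q rfl)
        fun q' hq' => ih _ (Prod.mk_lt_mk_iff_right.2 hq') p q' rfl
    · simp only [gcdDegree_comm (evalParam _ p)]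
      refine key q p hp h (fun q' hq' => ?_) fun p' hp' => ?_
      · simpa only [gcdDegree_comm (evalParam _ q')] using
          ih _ (Prod.mk_lt_mk_iff_right.2 hq') p q' rfl
      · simpa only [gcdDegree_comm (evalParam _ p')] using
          ih _ (Prod.mk_lt_mk_iff_left.2 hp') p' q rfl

end Parameters

end CountingPoly

namespace CountingPoly

open Polynomial

/-! ### Existence of counting polynomials of constructible sets -/

theorem exists_eval_append {m : ℕ} (p : MvPolynomial (Fin (m + 1)) ℂ) :
    ∃ P : (MvPolynomial (Fin m) ℂ)[X], ∀ (w : Fin m → ℂ) (t : ℂ),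
      MvPolynomial.eval (Fin.append w fun _ : Fin 1 => t) p = (evalParam w P).eval t := by
  induction p using MvPolynomial.induction_on with
  | C a => exact ⟨C (MvPolynomial.C a), by simp [evalParam]⟩
  | add p q hp hq =>
    obtain ⟨P, hP⟩ := hp
    obtain ⟨Q, hQ⟩ := hq
    exact ⟨P + Q, fun w t => by simp [evalParam, hP, hQ]⟩
  | mul_X p i hp =>
    obtain ⟨P, hP⟩ := hp
    have : ∃ Q : (MvPolynomial (Fin m) ℂ)[X], ∀ (w : Fin m → ℂ) (t : ℂ),
        (Fin.append w fun _ : Fin 1 => t) i = (evalParam w Q).eval t := by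
      refine Fin.addCases (fun j => ?_) (fun j => ?_) i
      · exact ⟨C (MvPolynomial.X j), fun w t => by simp [evalParam]⟩
      · exact ⟨X, fun w t => by simp [evalParam]⟩
    obtain ⟨Q, hQ⟩ := this
    exact ⟨P * Q, fun w t => by
      rw [map_mul, MvPolynomial.eval_X, hP, hQ]
      simp only [evalParam, Polynomial.map_mul, eval_mul]⟩

open Classical in
/-- The indicator function of `V` with values in `ℤ`. -/
noncomputable def indicatorInt {n : ℕ} (V : Set (Fin n → ℂ)) : (Fin n → ℂ) → ℤ :=
  fun v => if v ∈ V then 1 else 0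

/-- The indicator functions of the zero sets of polynomials. -/
def zeroSetIndicators (n : ℕ) : Set ((Fin n → ℂ) → ℤ) :=
  Set.range fun p : MvPolynomial (Fin n) ℂ => indicatorInt {a | MvPolynomial.eval a p = 0}

/-- Inclusion-exclusion: the union of two zero sets is the zero set of the product. Indicators of
constructible sets thereby reduce linearly to single polynomials. -/
theorem mul_mem_span_zeroSetIndicators {n : ℕ} {f g : (Fin n → ℂ) → ℤ}
    (hf : f ∈ Submodule.span ℤ (zeroSetIndicators n))
    (hg : g ∈ Submodule.span ℤ (zeroSetIndicators n)) :
    f * g ∈ Submodule.span ℤ (zeroSetIndicators n) := by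
  refine (?_ : Submodule.span ℤ (zeroSetIndicators n) * Submodule.span ℤ (zeroSetIndicators n) ≤
    Submodule.span ℤ (zeroSetIndicators n)) (Submodule.mul_mem_mul hf hg)
  rw [Submodule.span_mul_span, Submodule.span_le]
  rintro _ ⟨_, ⟨p, rfl⟩, _, ⟨q, rfl⟩, rfl⟩
  have e : indicatorInt {a | MvPolynomial.eval a p = 0} *
      indicatorInt {a | MvPolynomial.eval a q = 0} =
      indicatorInt {a | MvPolynomial.eval a p = 0} + indicatorInt {a | MvPolynomial.eval a q = 0} -
        indicatorInt {a | MvPolynomial.eval a (p * q) = 0} := by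
    ext a
    by_cases hp : MvPolynomial.eval a p = 0 <;> by_cases hq : MvPolynomial.eval a q = 0 <;>
      simp [indicatorInt, hp, hq]
  beta_reduce
  rw [SetLike.mem_coe, e]
  exact sub_mem (add_mem (Submodule.subset_span ⟨p, rfl⟩) (Submodule.subset_span ⟨q, rfl⟩))
    (Submodule.subset_span ⟨p * q, rfl⟩)

theorem IsConstructible.indicatorInt_mem_span {n : ℕ} {V : Set (Fin n → ℂ)}
    (hV : IsConstructible V) : indicatorInt V ∈ Submodule.span ℤ (zeroSetIndicators n) := by
  have hcompl : ∀ V : Set (Fin n → ℂ), indicatorInt V ∈ Submodule.span ℤ (zeroSetIndicators n) →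
      indicatorInt Vᶜ ∈ Submodule.span ℤ (zeroSetIndicators n) := by
    intro V hV
    have e : indicatorInt Vᶜ =
        indicatorInt {a | MvPolynomial.eval a (0 : MvPolynomial (Fin n) ℂ) = 0} -
          indicatorInt V := by
      ext a
      by_cases ha : a ∈ V <;> simp [indicatorInt, ha]
    rw [e]
    exact sub_mem (Submodule.subset_span ⟨0, rfl⟩) hV
  refine IsConstructible.induction
    (P := fun V => indicatorInt V ∈ Submodule.span ℤ (zeroSetIndicators n))
    (fun p => Submodule.subset_span ⟨p, rfl⟩)
    (fun V W hV hW => ?_) hcompl hV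
  have e : V ∪ W = (Vᶜ ∩ Wᶜ)ᶜ := by rw [Set.compl_inter, compl_compl, compl_compl]
  rw [e]
  refine hcompl _ ?_
  have e' : indicatorInt (Vᶜ ∩ Wᶜ) = indicatorInt Vᶜ * indicatorInt Wᶜ := by
    ext a
    by_cases ha : a ∈ V <;> by_cases hb : a ∈ W <;> simp [indicatorInt, ha, hb]
  rw [e']
  exact mul_mem_span_zeroSetIndicators (hcompl V hV) (hcompl W hW)

/-- For one polynomial, the integral over the last coordinate is `X` where it vanishes identically
in that coordinate, and elsewhere its number of distinct zeros. Linearity does the rest. -/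
theorem exists_isConstructibleFun_countIntegral {m : ℕ} {f : (Fin (m + 1) → ℂ) → ℤ}
    (hf : f ∈ Submodule.span ℤ (zeroSetIndicators (m + 1))) :
    ∃ F : (Fin m → ℂ) → ℤ[X], IsConstructibleFun F ∧
      ∀ w, countIntegral (fun t => C (f (Fin.append w fun _ : Fin 1 => t))) (F w) := by
  induction hf using Submodule.span_induction with
  | mem f hf =>
    obtain ⟨p, rfl⟩ := hf
    obtain ⟨P, hP⟩ := exists_eval_append p
    classical
    refine ⟨fun w => if evalParam w P = 0 then X else
      C (((evalParam w P).natDegree : ℤ) - gcdDegree (evalParam w P) (derivative (evalParam w P))),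
      ?_, fun w => ?_⟩
    · have hZ : IsConstructible {w : Fin m → ℂ | evalParam w P = 0} := by
        have : {w : Fin m → ℂ | evalParam w P = 0} =
            ⋂ i ∈ (P.support : Set ℕ), {w | MvPolynomial.eval w (P.coeff i) = 0} := by
          ext w
          simp only [Set.mem_ofPred_eq, Set.mem_iInter, Polynomial.ext_iff, evalParam, coeff_map,
            coeff_zero, Finset.mem_coe, mem_support_iff]
          refine forall_congr' fun i => ⟨fun h _ => h, fun h => ?_⟩
          by_cases hi : P.coeff i = 0
          · rw [hi, map_zero]
          · exact h hi
        rw [this]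
        exact IsConstructible.biInter P.support.finite_toSet fun i _ => IsConstructible.zeroSet _
      have hgcd : IsConstructibleFun fun w : Fin m → ℂ =>
          gcdDegree (evalParam w P) (derivative (evalParam w P)) := by
        simpa only [evalParam, derivative_map] using
          isConstructibleFun_gcdDegree P (derivative P)
      refine IsConstructibleFun.piecewise hZ (IsConstructibleFun.const X)
        (IsConstructibleFun.map₂ (fun a b : ℕ => (C ((a : ℤ) - b) : ℤ[X]))
          (isConstructibleFun_natDegree P) hgcd) (fun w hw => if_pos hw) fun w hw => if_neg hw
    · simp only [indicatorInt, Set.mem_ofPred_eq, hP]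
      split_ifs with h0
      · simpa [h0] using countIntegral_const 1
      · refine ⟨0, (evalParam w P).roots.toFinset, fun t ht => ?_, ?_⟩
        · rw [Multiset.mem_toFinset, mem_roots h0] at ht
          have ht' : ¬ (evalParam w P).eval t = 0 := ht
          simp only [if_neg ht', C_0]
        · have h1 : ∑ t ∈ (evalParam w P).roots.toFinset,
              ((C (if (evalParam w P).eval t = 0 then 1 else 0) : ℤ[X]) - 0) =
              ∑ t ∈ (evalParam w P).roots.toFinset, 1 := by
            refine Finset.sum_congr rfl fun t ht => ?_
            rw [Multiset.mem_toFinset, mem_roots h0] at ht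
            have ht' : (evalParam w P).eval t = 0 := ht
            rw [if_pos ht', C_1, sub_zero]
          rw [h1, ← card_roots_add_gcdDegree h0]
          simp
  | zero => exact ⟨fun _ => 0, IsConstructibleFun.const 0, fun w => by
      simpa using countIntegral_linear.zero⟩
  | add f g _ _ hf hg =>
    obtain ⟨F, hF, hfF⟩ := hf
    obtain ⟨G, hG, hgG⟩ := hg
    exact ⟨_, hF.map₂ (· + ·) hG, fun w => by simpa using (hfF w).add (hgG w)⟩
  | smul a f _ hf =>
    obtain ⟨F, hF, hfF⟩ := hf
    exact ⟨_, hF.comp (C a * ·), fun w => by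
      simpa only [Pi.smul_apply, smul_eq_mul, C_mul] using (hfF w).mul (C a)⟩

theorem isAffineLine_univ : IsAffineLine (Set.univ : Set (Fin 1 → ℂ)) :=
  ⟨⊤, by rw [AffineSubspace.direction_top, finrank_top, Module.finrank_fin_fun], rfl⟩

theorem IsPleskenCounting.of_compl_finite {U : Set (Fin 1 → ℂ)} (hU : IsConstructible U)
    (hfin : Uᶜ.Finite) : IsPleskenCounting U (X - C (Uᶜ.ncard : ℤ)) := by
  refine IsPleskenCounting.diff Uᶜ U _ _ hU.compl hU disjoint_compl_left
    (IsPleskenCounting.finite _ hfin) ?_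
  rw [Set.compl_union_self]
  exact IsPleskenCounting.line _ isAffineLine_univ

theorem hasCount_of_countIntegral {U : Set (Fin 1 → ℂ)} {a : ℤ[X]}
    (h : countIntegral (fun t => C (indicatorInt U fun _ => t)) a) : HasCount U a := by
  refine ⟨_, fun w => ?_, h⟩
  have e : ∀ u : Fin 0 → ℂ, (Fin.cons w u : Fin 1 → ℂ) = fun _ => w := by
    intro u
    ext j
    rw [Fin.fin_one_eq_zero j, Fin.cons_zero]
  constructor
  · rintro ⟨u, hu⟩
    rw [mem_slice, e] at hu
    simp [indicatorInt, hu]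
  · intro h
    have hw : (fun _ => w) ∉ U := fun hw => by
      have : (Fin.elim0 : Fin 0 → ℂ) ∈ slice w U := by
        rw [mem_slice, e]
        exact hw
      simp [h] at this
    simp [indicatorInt, hw]

theorem exists_isPleskenCounting_of_countIntegral {U : Set (Fin 1 → ℂ)} (hU : IsConstructible U)
    {a : ℤ[X]} (h : countIntegral (fun t => C (indicatorInt U fun _ => t)) a) :
    IsPleskenCounting U a ∧ (U.Nonempty → a ≠ 0) := by
  -- Any value obtained by the rules equals the integral `a`, so it is enough to find one.
  suffices ∃ c, IsPleskenCounting U c ∧ (U.Nonempty → c ≠ 0) by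
    obtain ⟨c, hc, hc0⟩ := this
    rw [(hasCount_of_countIntegral h).unique hc.hasCount]
    exact ⟨hc, hc0⟩
  obtain ⟨g, s, hs, -⟩ := h
  have hsfin : ((fun (t : ℂ) (_ : Fin 1) => t) '' s).Finite := s.finite_toSet.image _
  have he : ∀ u : Fin 1 → ℂ, (fun _ => u 0) = u := fun u => by
    ext j
    rw [Fin.fin_one_eq_zero j]
  -- The indicator takes only the values `0` and `1`, so `U` is finite if `g = 0` and cofinite
  -- otherwise.
  by_cases hg : g = 0
  · have hfin : U.Finite := hsfin.subset fun u hu => by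
      refine ⟨u 0, ?_, he u⟩
      by_contra hus
      have := hs _ hus
      beta_reduce at this
      rw [he, hg] at this
      simp [indicatorInt, hu] at this
    refine ⟨_, IsPleskenCounting.finite U hfin, fun hne h0 => ?_⟩
    rw [C_eq_zero, Nat.cast_eq_zero, Set.ncard_eq_zero hfin] at h0
    exact hne.ne_empty h0
  · have hfin : Uᶜ.Finite := hsfin.subset fun u hu => by
      refine ⟨u 0, ?_, he u⟩
      by_contra hus
      have := hs _ hus
      beta_reduce at this
      rw [he] at this
      refine hg (this.symm.trans ?_)
      have hu' : u ∉ U := hu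
      simp [indicatorInt, hu']
    refine ⟨_, IsPleskenCounting.of_compl_finite hU hfin, fun _ => ?_⟩
    exact X_sub_C_ne_zero _

theorem IsPleskenCounting.empty {n : ℕ} : IsPleskenCounting (∅ : Set (Fin n → ℂ)) 0 := by
  simpa using IsPleskenCounting.finite (∅ : Set (Fin n → ℂ)) Set.finite_empty

/-- `V` is cut into finitely many pieces by the value `F w` of the fiber in the last coordinate.
Each piece fibers over a constructible set of lower dimension, to which induction applies. -/
theorem IsConstructible.exists_isPleskenCounting : ∀ {n : ℕ} {V : Set (Fin n → ℂ)},
    IsConstructible V → ∃ c, IsPleskenCounting V c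
  | 0, V, _ => ⟨_, IsPleskenCounting.finite V V.toFinite⟩
  | m + 1, V, hV => by
    obtain ⟨F, hF, hFV⟩ := exists_isConstructibleFun_countIntegral hV.indicatorInt_mem_span
    have hfib : ∀ w, IsPleskenCounting (fiber V w) (F w) ∧ ((fiber V w).Nonempty → F w ≠ 0) :=
      fun w => exists_isPleskenCounting_of_countIntegral (isConstructible_fiber hV w) (hFV w)
    rcases Nat.eq_zero_or_pos m with rfl | hm
    · have : V = fiber V Fin.elim0 := by
        ext u
        simp only [fiber, Set.mem_ofPred_eq, Fin.elim0_append]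
        have : (u ∘ Fin.cast (zero_add 1) : Fin 1 → ℂ) = u := by
          ext j
          simp
        rw [this]
      refine ⟨F Fin.elim0, ?_⟩
      rw [this]
      exact (hfib Fin.elim0).1
    · have hVc : ∀ c, IsConstructible (V ∩ {v | F (proj m 1 v) = c}) := fun c =>
        hV.inter (hF.preimage c).preimage_proj
      have hpiece : ∀ c, ∃ d, IsPleskenCounting (V ∩ {v | F (proj m 1 v) = c}) d := by
        intro c
        obtain ⟨d, hd⟩ := IsConstructible.exists_isPleskenCounting (hF.preimage c)
        have hpr : ∀ (w : Fin m → ℂ) (u : Fin 1 → ℂ), proj m 1 (Fin.append w u) = w := fun w u => by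
          ext j
          simp [proj]
        have hsurj : ∀ v : Fin (m + 1) → ℂ, ∃ u, v = Fin.append (proj m 1 v) u := fun v =>
          ⟨fun j => v (Fin.natAdd m j), (Fin.append_castAdd_natAdd (f := v)).symm⟩
        have hfib' : ∀ w, F w = c → fiber (V ∩ {v | F (proj m 1 v) = c}) w = fiber V w := by
          intro w hw
          ext u
          simp [fiber, hpr, hw]
        -- The value `0` occurs exactly for empty fibers. So the piece for `c = 0` is empty, and for
        -- `c ≠ 0` the projection of the piece is all of `F ⁻¹' {c}`, hence constructible.
        by_cases hc : c = 0
        · have : V ∩ {v | F (proj m 1 v) = c} = ∅ := by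
            refine Set.eq_empty_of_forall_notMem fun v hv => ?_
            obtain ⟨u, hu⟩ := hsurj v
            exact (hfib (proj m 1 v)).2 ⟨u, by rw [fiber, Set.mem_ofPred_eq, ← hu]; exact hv.1⟩
              (hv.2.trans hc)
          rw [this]
          exact ⟨0, IsPleskenCounting.empty⟩
        · have himg : proj m 1 '' (V ∩ {v | F (proj m 1 v) = c}) = F ⁻¹' {c} := by
            ext w
            constructor
            · rintro ⟨v, hv, rfl⟩
              exact hv.2
            · intro hw
              obtain ⟨u, hu⟩ : (fiber V w).Nonempty := by
                by_contra hne
                rw [Set.not_nonempty_iff_eq_empty] at hne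
                have h1 := (hfib w).1.hasCount
                rw [hne] at h1
                exact hc (hw.symm.trans (h1.unique (IsIterated.empty countIntegral_linear 1)))
              exact ⟨Fin.append w u, ⟨hu, by rw [Set.mem_ofPred_eq, hpr]; exact hw⟩, hpr w u⟩
          refine ⟨c * d, IsPleskenCounting.fibration hm _ c d (hVc c) (fun w hw => ?_) ?_⟩
          · rw [himg] at hw
            have hw' : F w = c := hw
            rw [hfib' w hw', ← hw']
            exact (hfib w).1
          · rw [himg]
            exact hd
      have hall : ∀ T : Finset ℤ[X], ∃ d, IsPleskenCounting (V ∩ {v | F (proj m 1 v) ∈ T}) d ∧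
          IsConstructible (V ∩ {v | F (proj m 1 v) ∈ T}) := by
        intro T
        classical
        induction T using Finset.induction_on with
        | empty => exact ⟨0, by simpa using IsPleskenCounting.empty,
            by simpa using IsConstructible.empty⟩
        | insert c T hc ih =>
          obtain ⟨d, hd, hT⟩ := ih
          obtain ⟨d', hd'⟩ := hpiece c
          have e : V ∩ {v | F (proj m 1 v) ∈ insert c T} =
              (V ∩ {v | F (proj m 1 v) = c}) ∪ (V ∩ {v | F (proj m 1 v) ∈ T}) := by
            ext v
            simp [← and_or_left]
          rw [e]
          refine ⟨d' + d, IsPleskenCounting.union _ _ _ _ (hVc c) hT ?_ hd' hd, (hVc c).union hT⟩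
          rw [Set.disjoint_left]
          rintro v ⟨-, h1⟩ ⟨-, h2⟩
          exact hc (h1 ▸ h2)
      obtain ⟨d, hd, -⟩ := hall hF.finite_range.toFinset
      have e : V ∩ {v | F (proj m 1 v) ∈ hF.finite_range.toFinset} = V := by
        ext v
        simp
      exact ⟨d, e ▸ hd⟩

end CountingPoly

namespace CountingPoly

open Polynomial

/-! ### Leaders, initials and specializations -/

section Specialize

variable {n : ℕ} {B : Type*} [CommRing B] [Algebra ℂ B]

/-- The univariate polynomial obtained by substituting `a j` for the `j`-th variable, for `j ≠ i`,
with values in a `ℂ`-algebra. -/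
noncomputable def specializeIn (i : Fin n) (a : Fin n → B) : MvPolynomial (Fin n) ℂ →ₐ[ℂ] B[X] :=
  MvPolynomial.aeval fun j => if j = i then X else C (a j)

theorem specializeIn_eq (i : Fin n) (a : Fin n → ℂ) (p : MvPolynomial (Fin n) ℂ) :
    specializeIn i a p = specialize i a p := rfl

theorem specializeIn_monomial (i : Fin n) (a : Fin n → B) (m : Fin n →₀ ℕ) (c : ℂ) :
    specializeIn i a (MvPolynomial.monomial m c) =
      C (MvPolynomial.aeval a (MvPolynomial.monomial (m.erase i) c)) * X ^ m i := by
  rw [specializeIn, MvPolynomial.aeval_monomial, MvPolynomial.aeval_monomial,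
    ← Finsupp.mul_prod_erase' m i _ fun _ => pow_zero _, if_pos rfl]
  have : ((m.erase i).prod fun j k => (if j = i then X else C (a j)) ^ k) =
      C ((m.erase i).prod fun j k => a j ^ k) := by
    rw [Finsupp.prod, Finsupp.prod, map_prod]
    refine Finset.prod_congr rfl fun j hj => ?_
    have hji : j ≠ i := by
      rintro rfl
      simp at hj
    rw [if_neg hji, C_pow]
  rw [this, C_mul, Polynomial.algebraMap_apply]
  ring

theorem specializeIn_eq_sum (i : Fin n) (a : Fin n → B) (p : MvPolynomial (Fin n) ℂ) :
    specializeIn i a p = ∑ m ∈ p.support,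
      C (MvPolynomial.aeval a (MvPolynomial.monomial (m.erase i) (p.coeff m))) * X ^ m i := by
  conv_lhs => rw [p.as_sum, map_sum]
  exact Finset.sum_congr rfl fun m _ => specializeIn_monomial i a m _

theorem natDegree_specializeIn_le (i : Fin n) (a : Fin n → B) (p : MvPolynomial (Fin n) ℂ) :
    (specializeIn i a p).natDegree ≤ p.degreeOf i := by
  rw [specializeIn_eq_sum]
  refine natDegree_sum_le_of_forall_le _ _ fun m hm => (natDegree_C_mul_X_pow_le _ _).trans ?_
  exact MvPolynomial.monomial_le_degreeOf i hm

theorem coeff_specializeIn (i : Fin n) (a : Fin n → B) (p : MvPolynomial (Fin n) ℂ) :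
    (specializeIn i a p).coeff (p.degreeOf i) = MvPolynomial.aeval a (initial i p) := by
  rw [specializeIn_eq_sum, finsetSum_coeff, initial, map_sum, Finset.sum_filter]
  refine Finset.sum_congr rfl fun m _ => ?_
  rw [coeff_C_mul_X_pow]
  simp only [eq_comm]

/-- Needed over ℂ to count zeros, and with `B` a subalgebra of algebraic elements of `A` to prove
algebraicity. -/
theorem aeval_specializeIn {A : Type*} [CommRing A] [Algebra ℂ A] [Algebra B A]
    [IsScalarTower ℂ B A] (i : Fin n) (a : Fin n → B) (y : A) (p : MvPolynomial (Fin n) ℂ) :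
    Polynomial.aeval y (specializeIn i a p) =
      MvPolynomial.aeval (Function.update (fun j => algebraMap B A (a j)) i y) p := by
  have : (Polynomial.aeval (R := B) y).toRingHom.comp (specializeIn i a).toRingHom =
      (MvPolynomial.aeval (R := ℂ)
        (Function.update (fun j => algebraMap B A (a j)) i y)).toRingHom := by
    refine MvPolynomial.ringHom_ext (fun c => ?_) fun j => ?_
    · simp [specializeIn, Polynomial.algebraMap_apply, IsScalarTower.algebraMap_apply ℂ B A c]
    · by_cases hj : j = i
      · subst hj
        simp [specializeIn]
      · simp [specializeIn, hj]
  exact RingHom.congr_fun this p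

theorem aeval_eq_of_vars {x y : Fin n → B} {p : MvPolynomial (Fin n) ℂ}
    (h : ∀ j ∈ p.vars, x j = y j) : MvPolynomial.aeval x p = MvPolynomial.aeval y p :=
  MvPolynomial.eval₂Hom_congr' rfl (fun j hj _ => h j hj) rfl

theorem exists_isLeader {p : MvPolynomial (Fin n) ℂ} (hp : p.vars.Nonempty) : ∃ i, IsLeader p i :=
  ⟨_, p.vars.isGreatest_max' hp⟩

/-- Monomials with the same exponent at `i` stay distinct after erasing it, so no terms cancel. -/
theorem initial_ne_zero (i : Fin n) {p : MvPolynomial (Fin n) ℂ} (hp : p ≠ 0) :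
    initial i p ≠ 0 := by
  obtain ⟨m₀, hm₀, hd⟩ := p.support.exists_mem_eq_sup (MvPolynomial.support_nonempty.2 hp)
    fun m => m i
  rw [← MvPolynomial.degreeOf_eq_sup] at hd
  intro h
  have hc := congrArg (MvPolynomial.coeff (m₀.erase i)) h
  rw [initial, MvPolynomial.coeff_sum, MvPolynomial.coeff_zero, Finset.sum_eq_single m₀,
    MvPolynomial.coeff_monomial, if_pos rfl] at hc
  · exact MvPolynomial.mem_support_iff.1 hm₀ hc
  · intro m hm hne
    rw [MvPolynomial.coeff_monomial, if_neg]
    intro he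
    refine hne (Finsupp.ext fun j => ?_)
    by_cases hj : j = i
    · rw [hj, (Finset.mem_filter.1 hm).2, hd]
    · simpa [Finsupp.erase_ne hj] using DFunLike.congr_fun he j
  · intro h'
    exact (h' (Finset.mem_filter.2 ⟨hm₀, hd.symm⟩)).elim

theorem vars_initial {i j : Fin n} {p : MvPolynomial (Fin n) ℂ} (h : j ∈ (initial i p).vars) :
    j ∈ p.vars ∧ j ≠ i := by
  classical
  obtain ⟨m, hm, hj⟩ := Finset.mem_biUnion.1 (MvPolynomial.vars_sum_subset _ _ h)
  rw [MvPolynomial.vars_monomial (MvPolynomial.mem_support_iff.1 (Finset.mem_filter.1 hm).1)] at hj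
  rw [Finsupp.support_erase, Finset.mem_erase] at hj
  exact ⟨(MvPolynomial.mem_vars_iff_mem_support j).2 ⟨m, (Finset.mem_filter.1 hm).1, hj.2⟩, hj.1⟩

end Specialize

/-! ### Krull dimension and transcendence degree -/

/-- Noether normalization: an integral extension of a polynomial ring in `s` variables keeps its
transcendence degree and its dimension, by incomparability for `≤` and going up for `≥`. -/
theorem exists_ringKrullDim_eq_trdeg (k R : Type) [Field k] [CommRing R] [IsDomain R] [Algebra k R]
    [Algebra.FiniteType k R] : ∃ s : ℕ, ringKrullDim R = s ∧ Algebra.trdeg k R = s := by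
  obtain ⟨s, g, hg, hint⟩ := exists_integral_inj_algHom_of_fg k R
  let _ : Algebra (MvPolynomial (Fin s) k) R := g.toRingHom.toAlgebra
  have : IsScalarTower k (MvPolynomial (Fin s) k) R :=
    IsScalarTower.of_algebraMap_eq fun x => (g.commutes x).symm
  have hI : Algebra.IsIntegral (MvPolynomial (Fin s) k) R := ⟨hint⟩
  have hF : FaithfulSMul (MvPolynomial (Fin s) k) R :=
    (faithfulSMul_iff_algebraMap_injective _ _).2 hg
  have hdim : ringKrullDim (MvPolynomial (Fin s) k) = s := by simp
  refine ⟨s, le_antisymm ?_ ?_, ?_⟩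
  · rw [← hdim]
    refine Order.krullDim_le_of_strictMono
      (PrimeSpectrum.comap (algebraMap (MvPolynomial (Fin s) k) R)) fun p q hpq => ?_
    exact Ideal.IsIntegral.comap_lt_comap hpq
  · obtain ⟨l, hl⟩ := Order.le_krullDim_iff.1 hdim.ge
    obtain ⟨P, hP⟩ := Ideal.nonempty_primesOver (S := R) l.head.asIdeal
    have := hP.1
    have := hP.2
    obtain ⟨L, hL, -⟩ := Ideal.exists_ltSeries_of_hasGoingUp l P
    exact Order.le_krullDim_iff.2 ⟨L, hL.trans hl⟩
  · have h := trdeg_add_eq k (MvPolynomial (Fin s) k) (A := R)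
    rw [MvPolynomial.trdeg_of_isDomain, trdeg_eq_zero] at h
    simpa using h.symm

/-- The variables in `F` are algebraically independent modulo `J`. The initial of a nonzero relation
among them would be a nonzero relation in smaller variables of `F`, and the descent ends with a
nonzero constant in a proper ideal. -/
theorem card_le_ringKrullDim {n : ℕ} {J : Ideal (MvPolynomial (Fin n) ℂ)} (hJ : J.IsPrime)
    (F : Finset (Fin n)) (hF : ∀ i ∈ F, ∀ p ∈ J, IsLeader p i → initial i p ∈ J) :
    (F.card : WithBot ℕ∞) ≤ ringKrullDim (MvPolynomial (Fin n) ℂ ⧸ J) := by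
  have key : ∀ k : ℕ, ∀ f ∈ J, (∀ j ∈ f.vars, j ∈ F ∧ (j : ℕ) < k) → f = 0 := by
    intro k
    induction k using Nat.strong_induction_on with
    | _ k ih =>
      intro f hf hv
      by_contra h0
      rcases f.vars.eq_empty_or_nonempty with he | hne
      · rw [MvPolynomial.vars_eq_empty_iff_eq_C] at he
        rw [he] at hf h0
        refine hJ.ne_top (Ideal.eq_top_of_isUnit_mem J hf ?_)
        exact (isUnit_iff_ne_zero.2 fun h => h0 (by rw [h, MvPolynomial.C_0])).map MvPolynomial.C
      · obtain ⟨i, hi⟩ := exists_isLeader hne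
        refine initial_ne_zero i h0 (ih i (hv i hi.1).2 _ (hF i (hv i hi.1).1 f hf hi) ?_)
        intro j hj
        have hj' := vars_initial hj
        exact ⟨(hv j hj'.1).1, Fin.lt_def.1 (lt_of_le_of_ne (hi.2 hj'.1) hj'.2)⟩
  have hind : AlgebraicIndependent ℂ fun i : F => Ideal.Quotient.mk J (MvPolynomial.X (i : Fin n)) := by
    rw [algebraicIndependent_iff]
    intro q hq
    have hq' : MvPolynomial.rename (Subtype.val : F → Fin n) q ∈ J := by
      rw [← Ideal.Quotient.eq_zero_iff_mem, ← hq]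
      have : (Ideal.Quotient.mkₐ ℂ J).comp (MvPolynomial.rename (Subtype.val : F → Fin n)) =
          MvPolynomial.aeval fun i : F => Ideal.Quotient.mk J (MvPolynomial.X (i : Fin n)) := by
        ext i
        simp
      exact DFunLike.congr_fun this q
    refine MvPolynomial.rename_injective _ Subtype.val_injective ?_
    rw [map_zero]
    refine key n _ hq' fun j hj => ?_
    obtain ⟨i, -, rfl⟩ := MvPolynomial.mem_vars_rename _ _ hj
    exact ⟨i.2, (i : Fin n).2⟩
  obtain ⟨s, hs, hs'⟩ := exists_ringKrullDim_eq_trdeg ℂ (MvPolynomial (Fin n) ℂ ⧸ J)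
  have := hind.cardinalMk_le_trdeg
  rw [hs', Cardinal.mk_coe_finset] at this
  rw [hs]
  exact_mod_cast this

/-- With the smaller variables specialized to elements of the algebraic closure `K` of `S` in `A`,
`p` becomes an equation for `x i` over `K`. It is nonzero because the initial does not vanish, and
algebraicity is transitive. -/
theorem isAlgebraic_of_isLeader {n : ℕ} {S A : Type*} [CommRing S] [IsDomain S] [CommRing A]
    [IsDomain A] [Algebra ℂ S] [Algebra ℂ A] [Algebra S A] [IsScalarTower ℂ S A] {x : Fin n → A}
    {i : Fin n} (hx : ∀ j < i, IsAlgebraic S (x j)) {p : MvPolynomial (Fin n) ℂ}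
    (hp : IsLeader p i) (h0 : MvPolynomial.aeval x p = 0)
    (hi : MvPolynomial.aeval x (initial i p) ≠ 0) : IsAlgebraic S (x i) := by
  classical
  let K := Subalgebra.algebraicClosure S A
  let a : Fin n → K := fun j => if h : j < i then ⟨x j, hx j h⟩ else 0
  have ha : ∀ j < i, algebraMap K A (a j) = x j := fun j hj => by
    simp only [a, dif_pos hj]
    rfl
  refine IsAlgebraic.restrictScalars S (S := K) ⟨specializeIn i a p, fun hs => hi ?_, ?_⟩
  · have hc := coeff_specializeIn i a p
    rw [hs, coeff_zero] at hc
    have h' := congrArg (algebraMap K A) hc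
    rw [map_zero, ← MvPolynomial.aeval_algebraMap_apply] at h'
    rw [h']
    refine aeval_eq_of_vars fun j hj => ?_
    have hj' := vars_initial hj
    exact (ha j (lt_of_le_of_ne (hp.2 hj'.1) hj'.2)).symm
  · rw [aeval_specializeIn, ← h0]
    refine aeval_eq_of_vars fun j hj => ?_
    rcases (hp.2 hj).eq_or_lt with rfl | hlt
    · simp
    · rw [Function.update_of_ne hlt.ne, ha j hlt]

/-- Each coordinate outside `F` is algebraic over the earlier ones, so `A` is algebraic over the
subalgebra generated by the coordinates in `F`. -/
theorem trdeg_le_card {n : ℕ} {A : Type} [CommRing A] [IsDomain A] [Algebra ℂ A] {x : Fin n → A}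
    (hx : Function.Surjective (MvPolynomial.aeval (R := ℂ) x)) (F : Finset (Fin n))
    (hF : ∀ i ∉ F, ∃ p, IsLeader p i ∧ MvPolynomial.aeval x p = 0 ∧
      MvPolynomial.aeval x (initial i p) ≠ 0) : Algebra.trdeg ℂ A ≤ F.card := by
  classical
  set s : Set A := x '' F
  have hmem : ∀ i, IsAlgebraic (Algebra.adjoin ℂ s) (x i) := by
    intro i
    induction i using WellFoundedLT.induction with
    | ind i ih =>
      by_cases hi : i ∈ F
      · have : x i ∈ Algebra.adjoin ℂ s := Algebra.subset_adjoin (Set.mem_image_of_mem x hi)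
        exact isAlgebraic_algebraMap (⟨x i, this⟩ : Algebra.adjoin ℂ s)
      · obtain ⟨p, hp, hp0, hpi⟩ := hF i hi
        exact isAlgebraic_of_isLeader ih hp hp0 hpi
  have halg : Algebra.IsAlgebraic (Algebra.adjoin ℂ s) A := by
    refine ⟨fun y => ?_⟩
    obtain ⟨p, rfl⟩ := hx y
    induction p using MvPolynomial.induction_on with
    | C c =>
      rw [MvPolynomial.aeval_C, IsScalarTower.algebraMap_apply ℂ (Algebra.adjoin ℂ s) A]
      exact isAlgebraic_algebraMap _
    | add p q hp hq =>
      rw [map_add]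
      exact hp.add hq
    | mul_X p j hp =>
      rw [map_mul, MvPolynomial.aeval_X]
      exact hp.mul (hmem j)
  refine (Algebra.IsAlgebraic.trdeg_le_cardinalMk ℂ s).trans (Cardinal.mk_image_le.trans ?_)
  simp

theorem ringKrullDim_le_card {n : ℕ} {J : Ideal (MvPolynomial (Fin n) ℂ)} (hJ : J.IsPrime)
    (F : Finset (Fin n)) (hF : ∀ i ∉ F, ∃ p ∈ J, IsLeader p i ∧ initial i p ∉ J) :
    ringKrullDim (MvPolynomial (Fin n) ℂ ⧸ J) ≤ F.card := by
  have hxe : ∀ p, MvPolynomial.aeval (fun i => Ideal.Quotient.mk J (MvPolynomial.X i)) p =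
      Ideal.Quotient.mk J p := fun p => by
    have : MvPolynomial.aeval (fun i => Ideal.Quotient.mk J (MvPolynomial.X i)) =
        Ideal.Quotient.mkₐ ℂ J := by
      ext i
      simp
    exact DFunLike.congr_fun this p
  have h := trdeg_le_card (x := fun i => Ideal.Quotient.mk J (MvPolynomial.X i))
    (fun y => by
      obtain ⟨p, rfl⟩ := Ideal.Quotient.mk_surjective y
      exact ⟨p, hxe p⟩) F fun i hi => by
    obtain ⟨p, hp, hpi, hpi'⟩ := hF i hi
    exact ⟨p, hpi, by rwa [hxe, Ideal.Quotient.eq_zero_iff_mem], by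
      rwa [hxe, ne_eq, Ideal.Quotient.eq_zero_iff_mem]⟩
  obtain ⟨d, hd, hd'⟩ := exists_ringKrullDim_eq_trdeg ℂ (MvPolynomial (Fin n) ℂ ⧸ J)
  rw [hd'] at h
  rw [hd]
  exact_mod_cast h

end CountingPoly

namespace CountingPoly

open Polynomial

/-! ### The degree of the counting polynomial of a Zariski closed set -/

/-- Next values are zeros of `p` specialized at `a`, which is nonzero because the initial does not
vanish at `a`. -/
theorem encard_nextValues_le {n : ℕ} {V : Set (Fin n → ℂ)} {a : Fin n → ℂ} {i : Fin n}
    {p : MvPolynomial (Fin n) ℂ} (hp : IsLeader p i) (hV : ∀ b ∈ V, MvPolynomial.eval b p = 0)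
    (hi : MvPolynomial.eval a (initial i p) ≠ 0) :
    (nextValues V a i).encard ≤ p.degreeOf i := by
  have h0 : specializeIn i a p ≠ 0 := fun h => hi <| by
    have := coeff_specializeIn i a p
    rw [h, coeff_zero] at this
    exact this.symm
  have hsub : nextValues V a i ⊆ ((specializeIn i a p).roots.toFinset : Set ℂ) := by
    rintro t ⟨b, hb, hba, rfl⟩
    rw [Finset.mem_coe, Multiset.mem_toFinset, mem_roots h0, IsRoot.def, ← coe_aeval_eq_eval,
      aeval_specializeIn, ← hV b hb]
    refine aeval_eq_of_vars fun j hj => ?_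
    rcases (hp.2 hj).eq_or_lt with rfl | hlt
    · simp
    · rw [Function.update_of_ne hlt.ne, hba j hlt]
      rfl
  refine (Set.encard_le_encard hsub).trans ?_
  rw [Set.encard_coe_eq_coe_finsetCard]
  exact_mod_cast (Multiset.toFinset_card_le _).trans
    ((card_roots' _).trans (natDegree_specializeIn_le i a p))

theorem freeCount_eq_card {n : ℕ} (D : Fin n → ℕ) (F : Finset (Fin n)) (h : ∀ i, i ∈ F ↔ D i = 0) :
    freeCount D = F.card := by
  rw [freeCount, Finset.card_eq_sum_ones, ← Finset.sum_filter]
  refine Finset.sum_congr ?_ fun _ _ => rfl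
  ext i
  simp [h]

namespace IsConstructible

variable {n : ℕ} {V W : Set (Fin n → ℂ)}

theorem exists_hasCount (hV : IsConstructible V) : ∃ c, HasCount V c :=
  let ⟨c, hc⟩ := hV.exists_isPleskenCounting
  ⟨c, hc.hasCount⟩

theorem zeroLocus (J : Ideal (MvPolynomial (Fin n) ℂ)) :
    IsConstructible (MvPolynomial.zeroLocus ℂ J) := by
  obtain ⟨s, rfl⟩ := (isNoetherianRing_iff_ideal_fg _).1 inferInstance J
  have : MvPolynomial.zeroLocus ℂ (Ideal.span (s : Set (MvPolynomial (Fin n) ℂ))) =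
      ⋂ p ∈ (s : Set (MvPolynomial (Fin n) ℂ)), {a | MvPolynomial.eval a p = 0} := by
    rw [MvPolynomial.zeroLocus_span]
    ext a
    simp [MvPolynomial.aeval_eq_eval]
  rw [this]
  exact biInter s.finite_toSet fun p _ => zeroSet p

theorem degree_le_of_subset (hV : IsConstructible V) (hW : IsConstructible W) (h : V ⊆ W)
    {c d : ℤ[X]} (hc : HasCount V c) (hd : HasCount W d) : c.degree ≤ d.degree := by
  obtain ⟨e, he⟩ := (hW.diff hV).exists_hasCount
  obtain ⟨h1, h2⟩ := hc.degree_le_union he Set.disjoint_sdiff_right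
  rw [Set.union_sdiff_cancel h] at h1
  rw [hd.unique h1, h2]
  exact le_max_left _ _

theorem degree_lt_of_union (hV : IsConstructible V) (hW : IsConstructible W) {c d e : ℤ[X]}
    (hc : HasCount V c) (hd : HasCount W d) (he : HasCount (V ∪ W) e) {k : WithBot ℕ}
    (hck : c.degree < k) (hdk : d.degree < k) : e.degree < k := by
  obtain ⟨f, hf⟩ := (hW.diff hV).exists_hasCount
  obtain ⟨h1, h2⟩ := hc.degree_le_union hf Set.disjoint_sdiff_right
  rw [Set.union_sdiff_self] at h1
  rw [he.unique h1, h2]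
  exact max_lt hck ((degree_le_of_subset (hW.diff hV) hW Set.sdiff_subset hf hd).trans_lt hdk)

end IsConstructible

theorem mem_zeroLocus_sup_span {n : ℕ} {J : Ideal (MvPolynomial (Fin n) ℂ)}
    {h : MvPolynomial (Fin n) ℂ} {a : Fin n → ℂ} :
    a ∈ MvPolynomial.zeroLocus ℂ (J ⊔ Ideal.span {h}) ↔
      a ∈ MvPolynomial.zeroLocus ℂ J ∧ MvPolynomial.eval a h = 0 := by
  constructor
  · exact fun ha => ⟨fun p hp => ha p (Ideal.mem_sup_left hp),
      ha h (Ideal.mem_sup_right (Ideal.mem_span_singleton_self h))⟩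
  · rintro ⟨h1, h2⟩ p hp
    obtain ⟨x, hx, y, hy, rfl⟩ := Submodule.mem_sup.1 hp
    obtain ⟨z, rfl⟩ := Ideal.mem_span_singleton'.1 hy
    rw [map_add, h1 x hx, map_mul]
    have : MvPolynomial.aeval a h = 0 := h2
    rw [this, mul_zero, add_zero]

theorem lt_sup_span_singleton {R : Type*} [CommRing R] {J : Ideal R} {h : R} (hh : h ∉ J) :
    J < J ⊔ Ideal.span {h} :=
  lt_of_le_of_ne le_sup_left fun e =>
    hh (e ▸ Ideal.mem_sup_right (Ideal.mem_span_singleton_self h))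

theorem ringKrullDim_quotient_le_of_le {R : Type*} [CommRing R] {I J : Ideal R} (h : I ≤ J) :
    ringKrullDim (R ⧸ J) ≤ ringKrullDim (R ⧸ I) :=
  ringKrullDim_le_of_surjective (Ideal.Quotient.factor h) (Ideal.Quotient.factor_surjective h)

/-- The locus of a family of polynomials with prescribed leaders where no initial vanishes. -/
theorem HasLead.leadAtMost_of_isLeader {n : ℕ} {V : Set (Fin n → ℂ)} {q : ℕ[X]} (hq : HasLead V q)
    (D : Fin n → ℕ) (h : ∀ i, D i ≠ 0 → ∃ p : MvPolynomial (Fin n) ℂ, IsLeader p i ∧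
      p.degreeOf i = D i ∧ ∀ a ∈ V, MvPolynomial.eval a p = 0 ∧
        MvPolynomial.eval a (initial i p) ≠ 0) :
    LeadAtMost q (freeCount D) (sheetCount D) := by
  refine hq.leadAtMost D fun i hi a ha => ?_
  obtain ⟨p, hp, hD, hV⟩ := h i hi
  rw [← hD]
  exact encard_nextValues_le hp (fun b hb => (hV b hb).1) (hV a ha).2

/-- Noetherian induction. If `x * y ∈ J` with neither factor in `J`, the zero locus is the union of
two smaller cases. If `J` is prime, it is cut along a product `h ∉ J` of initials: the part `h = 0`
belongs to a larger ideal, and elsewhere polynomials of `J` bound the next values. -/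
theorem degree_lt_of_ringKrullDim_lt {n : ℕ} (e : ℕ) (J : Ideal (MvPolynomial (Fin n) ℂ)) :
    ringKrullDim (MvPolynomial (Fin n) ℂ ⧸ J) < e → ∀ c : ℤ[X],
      HasCount (MvPolynomial.zeroLocus ℂ J) c → c.degree < e := by
  induction J using IsNoetherian.induction with
  | hgt J ih =>
    intro hdim c hc
    have ih' : ∀ h ∉ J, ∃ d, HasCount (MvPolynomial.zeroLocus ℂ (J ⊔ Ideal.span {h})) d ∧
        d.degree < e := by
      intro h hh
      obtain ⟨d, hd⟩ := (IsConstructible.zeroLocus (J ⊔ Ideal.span {h})).exists_hasCount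
      exact ⟨d, hd, ih _ (lt_sup_span_singleton hh)
        ((ringKrullDim_quotient_le_of_le le_sup_left).trans_lt hdim) d hd⟩
    by_cases htop : J = ⊤
    · rw [htop, MvPolynomial.zeroLocus_top] at hc
      rw [hc.unique (IsIterated.empty countIntegral_linear n), degree_zero]
      exact WithBot.bot_lt_coe e
    by_cases hJ : Ideal.IsPrime J
    · classical
      -- These variables are independent modulo `J`, so there are fewer than `e` of them. Every
      -- other variable leads some `p i ∈ J` whose initial lies outside `J`.
      set F : Finset (Fin n) :=
        Finset.univ.filter fun i => ∀ p ∈ J, IsLeader p i → initial i p ∈ J with hF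
      have hcard := card_le_ringKrullDim hJ F fun i hi => (Finset.mem_filter.1 hi).2
      have hex : ∀ i, ∃ p, i ∉ F → p ∈ J ∧ IsLeader p i ∧ initial i p ∉ J := by
        intro i
        by_cases hi : i ∈ F
        · exact ⟨0, fun h => (h hi).elim⟩
        · simp only [hF, Finset.mem_filter, Finset.mem_univ, true_and] at hi
          push Not at hi
          obtain ⟨p, h⟩ := hi
          exact ⟨p, fun _ => h⟩
      choose p hp using hex
      set h := ∏ i ∈ Fᶜ, initial i (p i) with hh
      have hhJ : h ∉ J := fun hmem => by
        rw [hh, hJ.prod_mem_iff] at hmem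
        obtain ⟨i, hi, hi'⟩ := hmem
        exact (hp i (Finset.mem_compl.1 hi)).2.2 hi'
      obtain ⟨d, hd, hde⟩ := ih' h hhJ
      set V := MvPolynomial.zeroLocus ℂ J \ {a | MvPolynomial.eval a h = 0} with hV
      have hVc : IsConstructible V :=
        (IsConstructible.zeroLocus J).diff (IsConstructible.zeroSet h)
      obtain ⟨b, hb⟩ := hVc.exists_hasCount
      obtain ⟨q, hq, hbq⟩ := hb.exists_hasLead
      set D : Fin n → ℕ := fun i => if i ∈ F then 0 else (p i).degreeOf i with hD
      have hDF : ∀ i, i ∈ F ↔ D i = 0 := by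
        intro i
        simp only [hD]
        split_ifs with hi
        · simp [hi]
        · simp only [hi, false_iff]
          exact (MvPolynomial.mem_vars_iff_degreeOf_ne_zero).1 (hp i hi).2.1.1
      have hmost := hq.leadAtMost_of_isLeader D fun i hi => by
        have hiF : i ∉ F := fun hiF => hi ((hDF i).1 hiF)
        refine ⟨p i, (hp i hiF).2.1, by simp [hD, hiF], fun a ha => ⟨ha.1 _ (hp i hiF).1, ?_⟩⟩
        intro h0
        refine ha.2 ?_
        rw [Set.mem_ofPred_eq, hh, map_prod]
        exact Finset.prod_eq_zero (Finset.mem_compl.2 hiF) h0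
      rw [freeCount_eq_card D F hDF] at hmost
      have hlt : F.card < e := by exact_mod_cast hcard.trans_lt hdim
      have hbe : b.degree < e := by
        rw [hbq.1]
        exact degree_le_natDegree.trans_lt (by exact_mod_cast hmost.1.trans_lt hlt)
      have hun : V ∪ MvPolynomial.zeroLocus ℂ (J ⊔ Ideal.span {h}) =
          MvPolynomial.zeroLocus ℂ J := by
        ext a
        rw [Set.mem_union, mem_zeroLocus_sup_span, hV, Set.mem_sdiff, Set.mem_ofPred_eq]
        tauto
      rw [← hun] at hc
      exact hVc.degree_lt_of_union (IsConstructible.zeroLocus _) hb hd hc hbe hde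
    · rw [Ideal.isPrime_iff] at hJ
      push Not at hJ
      obtain ⟨x, y, hxy, hx, hy⟩ := hJ htop
      obtain ⟨d, hd, hde⟩ := ih' x hx
      obtain ⟨d', hd', hde'⟩ := ih' y hy
      have hun : MvPolynomial.zeroLocus ℂ (J ⊔ Ideal.span {x}) ∪
          MvPolynomial.zeroLocus ℂ (J ⊔ Ideal.span {y}) = MvPolynomial.zeroLocus ℂ J := by
        ext a
        rw [Set.mem_union, mem_zeroLocus_sup_span, mem_zeroLocus_sup_span, ← and_or_left,
          and_iff_left_iff_imp]
        intro ha
        have := ha _ hxy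
        rw [map_mul, mul_eq_zero] at this
        exact this
      rw [← hun] at hc
      exact (IsConstructible.zeroLocus _).degree_lt_of_union (IsConstructible.zeroLocus _) hd hd' hc
        hde hde'

/-! ### Dimension bound from nonvanishing initials -/

/-- A chain of primes lies above a minimal prime `P`. Nonzerodivisors avoid `P`, so the bound for
prime ideals applies to its preimage. -/
theorem ringKrullDim_quotient_le_card {n : ℕ} {I : Ideal (MvPolynomial (Fin n) ℂ)}
    (F : Finset (Fin n)) (p : Fin n → MvPolynomial (Fin n) ℂ)
    (hp : ∀ i ∉ F, p i ∈ I ∧ IsLeader (p i) i ∧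
      Ideal.Quotient.mk I (initial i (p i)) ∈ nonZeroDivisors (MvPolynomial (Fin n) ℂ ⧸ I)) :
    ringKrullDim (MvPolynomial (Fin n) ℂ ⧸ I) ≤ F.card := by
  refine iSup_le fun l => ?_
  obtain ⟨P, hP, hPl⟩ := Ideal.exists_minimalPrimes_le (J := l.head.asIdeal) bot_le
  have hPp : P.IsPrime := hP.1.1
  set Q := P.comap (Ideal.Quotient.mk I) with hQ
  have hQp : Q.IsPrime := Ideal.comap_isPrime _ _
  have h1 : ringKrullDim (MvPolynomial (Fin n) ℂ ⧸ Q) ≤ F.card := by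
    refine ringKrullDim_le_card hQp F fun i hi => ⟨p i, ?_, (hp i hi).2.1, fun hmem => ?_⟩
    · rw [hQ, Ideal.mem_comap, Ideal.Quotient.eq_zero_iff_mem.2 (hp i hi).1]
      exact P.zero_mem
    · exact Set.disjoint_left.1 (Ideal.disjoint_nonZeroDivisors_of_mem_minimalPrimes hP) hmem
        (hp i hi).2.2
  have h2 : ringKrullDim ((MvPolynomial (Fin n) ℂ ⧸ I) ⧸ P) ≤
      ringKrullDim (MvPolynomial (Fin n) ℂ ⧸ Q) :=
    ringKrullDim_le_of_surjective (Ideal.quotientMap P (Ideal.Quotient.mk I) le_rfl)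
      (Ideal.quotientMap_surjective Ideal.Quotient.mk_surjective)
  refine le_trans ?_ (h2.trans h1)
  rw [ringKrullDim_quotient]
  let l' : LTSeries (PrimeSpectrum.zeroLocus (P : Set (MvPolynomial (Fin n) ℂ ⧸ I))) :=
    { length := l.length
      toFun := fun k => ⟨l k, hPl.trans (LTSeries.head_le l k)⟩
      step := fun k => l.step k }
  exact le_iSup (fun l : LTSeries (PrimeSpectrum.zeroLocus (P : Set (MvPolynomial (Fin n) ℂ ⧸ I))) =>
    (l.length : WithBot ℕ∞)) l'

end CountingPoly

namespace CountingPoly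

open Polynomial

/-! ### Towers of sets have algebraic counting polynomials -/

theorem IsConstructible.of_fin_zero (V : Set (Fin 0 → ℂ)) : IsConstructible V := by
  rcases V.eq_empty_or_nonempty with rfl | h
  · exact IsConstructible.empty
  · rw [Set.Nonempty.eq_univ h]
    exact IsConstructible.univ

theorem IsAlgCounting.empty {n : ℕ} : IsAlgCounting (∅ : Set (Fin n → ℂ)) 0 := by
  simpa using IsAlgCounting.constructible (∅ : Set (Fin n → ℂ)) 0 IsConstructible.empty
    IsPleskenCounting.empty

/-- The last coordinate is split off: the fiber over a projected point is the set of next values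
there, and the projection has the same earlier next values as `V`. -/
theorem exists_isAlgCounting_of_nextValues : ∀ {n : ℕ} {V : Set (Fin n → ℂ)},
    (∀ i, ∃ c, ∀ a ∈ V, IsAlgCounting {u : Fin 1 → ℂ | u 0 ∈ nextValues V a i} c) →
    ∃ p, IsAlgCounting V p
  | 0, V, _ => ⟨_, IsAlgCounting.constructible V _ (IsConstructible.of_fin_zero V)
      (IsPleskenCounting.finite V V.toFinite)⟩
  | m + 1, V, h => by
    rcases V.eq_empty_or_nonempty with rfl | ⟨a₀, ha₀⟩
    · exact ⟨0, IsAlgCounting.empty⟩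
    rcases Nat.eq_zero_or_pos m with rfl | hm
    · obtain ⟨c, hc⟩ := h 0
      refine ⟨c, ?_⟩
      have : V = {u : Fin 1 → ℂ | u 0 ∈ nextValues V a₀ 0} := by
        ext u
        constructor
        · exact fun hu => ⟨u, hu, fun j hj => (Fin.not_lt_zero j hj).elim, rfl⟩
        · rintro ⟨b, hb, -, hbu⟩
          have : b = u := by
            ext j
            rw [Fin.fin_one_eq_zero j]
            exact hbu
          exact this ▸ hb
      rw [this]
      exact hc a₀ ha₀
    · have hnext : ∀ a ∈ V, ∀ i : Fin m, nextValues (proj m 1 '' V) (proj m 1 a) i =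
          nextValues V a (Fin.castAdd 1 i) := by
        intro a _ i
        ext t
        constructor
        · rintro ⟨_, ⟨b, hb, rfl⟩, hba, hbt⟩
          refine ⟨b, hb, fun j hj => ?_, hbt⟩
          exact hba ⟨j, (Fin.lt_def.1 hj).trans i.2⟩ hj
        · rintro ⟨b, hb, hba, hbt⟩
          exact ⟨_, ⟨b, hb, rfl⟩, fun j hj => hba (Fin.castAdd 1 j) hj, hbt⟩
      obtain ⟨d, hd⟩ := exists_isAlgCounting_of_nextValues (V := proj m 1 '' V) fun i => by
        obtain ⟨c, hc⟩ := h (Fin.castAdd 1 i)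
        refine ⟨c, ?_⟩
        rintro _ ⟨a, ha, rfl⟩
        rw [hnext a ha]
        exact hc a ha
      obtain ⟨c, hc⟩ := h (Fin.last m)
      refine ⟨c * d, IsAlgCounting.fibration hm V c d ?_ hd⟩
      rintro _ ⟨a, ha, rfl⟩
      have : fiber V (proj m 1 a) = {u : Fin 1 → ℂ | u 0 ∈ nextValues V a (Fin.last m)} := by
        ext u
        constructor
        · intro hu
          refine ⟨_, hu, fun j hj => ?_, ?_⟩
          · obtain ⟨j, rfl⟩ : ∃ j' : Fin m, j = Fin.castAdd 1 j' := ⟨⟨j, hj⟩, rfl⟩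
            rw [Fin.append_left]
            rfl
          · exact Fin.append_right _ u 0
        · rintro ⟨b, hb, hba, hbu⟩
          have : Fin.append (proj m 1 a) u = b := by
            ext j
            refine Fin.addCases (fun j => ?_) (fun j => ?_) j
            · rw [Fin.append_left]
              exact (hba _ (Fin.lt_def.2 j.2)).symm
            · rw [Fin.append_right, Fin.fin_one_eq_zero j]
              exact hbu.symm
          rw [fiber, Set.mem_ofPred_eq, this]
          exact hb
      rw [this]
      exact hc a ha

/-! ### Solutions of simple systems -/

namespace SigmaSystem

variable {n : ℕ} {S : SigmaSystem n}

/-- The points that satisfy all members of `S` that involve only the first `k` variables. -/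
def partialSolutions (S : SigmaSystem n) (k : ℕ) : Set (Fin n → ℂ) :=
  {a | (∀ p ∈ S.eqs, (∀ j ∈ p.vars, (j : ℕ) < k) → MvPolynomial.eval a p = 0) ∧
    ∀ p ∈ S.ineqs, (∀ j ∈ p.vars, (j : ℕ) < k) → MvPolynomial.eval a p ≠ 0}

/-- The values for the `i`-th coordinate that satisfy all members of `S` with leader `i`. -/
def admissible (S : SigmaSystem n) (a : Fin n → ℂ) (i : Fin n) : Set ℂ :=
  {t | (∀ p ∈ S.eqs, IsLeader p i → (specialize i a p).eval t = 0) ∧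
    ∀ p ∈ S.ineqs, IsLeader p i → (specialize i a p).eval t ≠ 0}

theorem below_solutions (S : SigmaSystem n) (i : Fin n) :
    (S.below i).solutions = S.partialSolutions i := by
  ext a
  simp only [solutions, below, partialSolutions, Set.mem_ofPred_eq, and_imp, Fin.lt_def]

theorem partialSolutions_eq_solutions (S : SigmaSystem n) : S.partialSolutions n = S.solutions := by
  ext a
  simp [partialSolutions, solutions]

theorem IsSimple.partialSolutions_zero (hS : S.IsSimple) : S.partialSolutions 0 = Set.univ := by
  refine Set.eq_univ_of_forall fun a => ⟨fun p hp h => ?_, fun p hp h => ?_⟩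
  · obtain ⟨j, hj⟩ := hS.weaklyTriangular.1 p (Or.inl hp)
    exact (Nat.not_lt_zero _ (h j hj)).elim
  · obtain ⟨j, hj⟩ := hS.weaklyTriangular.1 p (Or.inr hp)
    exact (Nat.not_lt_zero _ (h j hj)).elim

theorem eval_specialize_of_agree {a b : Fin n → ℂ} {i : Fin n} {p : MvPolynomial (Fin n) ℂ}
    (hp : IsLeader p i) (hab : ∀ j < i, b j = a j) :
    (specialize i a p).eval (b i) = MvPolynomial.eval b p := by
  rw [← specializeIn_eq, ← coe_aeval_eq_eval, aeval_specializeIn]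
  refine aeval_eq_of_vars fun j hj => ?_
  rcases (hp.2 hj).eq_or_lt with rfl | hlt
  · simp
  · rw [Function.update_of_ne hlt.ne, hab j hlt]
    rfl

theorem eval_congr_vars {a b : Fin n → ℂ} {p : MvPolynomial (Fin n) ℂ}
    (h : ∀ j ∈ p.vars, a j = b j) : MvPolynomial.eval a p = MvPolynomial.eval b p :=
  aeval_eq_of_vars h

theorem mem_partialSolutions_succ {a b : Fin n → ℂ} {i : Fin n}
    (ha : a ∈ S.partialSolutions i) (hb : b i ∈ S.admissible a i) (hab : ∀ j < i, b j = a j) :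
    b ∈ S.partialSolutions (i + 1) := by
  have key : ∀ p ∈ S.eqs ∪ S.ineqs, (∀ j ∈ p.vars, (j : ℕ) < i + 1) →
      (∀ j ∈ p.vars, (j : ℕ) < i) ∨ IsLeader p i := by
    intro p hp h
    by_cases hi : i ∈ p.vars
    · exact Or.inr ⟨hi, fun j hj => Fin.le_def.2 (Nat.lt_succ_iff.1 (h j hj))⟩
    · refine Or.inl fun j hj => lt_of_le_of_ne (Nat.lt_succ_iff.1 (h j hj)) fun e => hi ?_
      exact (Fin.ext e : j = i) ▸ hj
  refine ⟨fun p hp h => ?_, fun p hp h => ?_⟩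
  · rcases key p (Or.inl hp) h with h' | h'
    · rw [eval_congr_vars fun j hj => hab j (h' j hj)]
      exact ha.1 p hp h'
    · rw [← eval_specialize_of_agree h' hab]
      exact hb.1 p hp h'
  · rcases key p (Or.inr hp) h with h' | h'
    · rw [eval_congr_vars fun j hj => hab j (h' j hj)]
      exact ha.2 p hp h'
    · rw [← eval_specialize_of_agree h' hab]
      exact hb.2 p hp h'

/-- The zeros of the specialization of `p` at `a`. -/
noncomputable def rootSet (i : Fin n) (a : Fin n → ℂ) (p : MvPolynomial (Fin n) ℂ) : Finset ℂ :=
  (specialize i a p).roots.toFinset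

section Member

variable {p : MvPolynomial (Fin n) ℂ} {i : Fin n} {a : Fin n → ℂ}

theorem IsSimple.specialize_ne_zero (hS : S.IsSimple) (hp : p ∈ S.eqs ∪ S.ineqs)
    (hi : IsLeader p i) (ha : a ∈ S.partialSolutions i) : specialize i a p ≠ 0 :=
  (hS.squareFree p hp i hi a (S.below_solutions i ▸ ha)).ne_zero

theorem IsSimple.mem_rootSet (hS : S.IsSimple) (hp : p ∈ S.eqs ∪ S.ineqs)
    (hi : IsLeader p i) (ha : a ∈ S.partialSolutions i) {t : ℂ} :
    t ∈ rootSet i a p ↔ (specialize i a p).eval t = 0 := by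
  rw [rootSet, Multiset.mem_toFinset, mem_roots (hS.specialize_ne_zero hp hi ha), IsRoot.def]

/-- Square-freeness makes all zeros simple and the nonvanishing initial fixes the degree, so the
number of zeros does not depend on `a`. -/
theorem IsSimple.card_rootSet (hS : S.IsSimple) (hp : p ∈ S.eqs ∪ S.ineqs)
    (hi : IsLeader p i) (ha : a ∈ S.partialSolutions i) : (rootSet i a p).card = p.degreeOf i := by
  have ha' : a ∈ (S.below i).solutions := S.below_solutions i ▸ ha
  have hsep : (specialize i a p).Separable :=
    PerfectField.separable_iff_squarefree.2 (hS.squareFree p hp i hi a ha')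
  have hdeg : (specialize i a p).natDegree = p.degreeOf i := by
    refine le_antisymm (natDegree_specializeIn_le i a p) (le_natDegree_of_ne_zero ?_)
    have := coeff_specializeIn i a p
    rw [← specializeIn_eq, this]
    exact hS.nonvanishingInitials p hp i hi a ha'
  rw [rootSet, Multiset.toFinset_card_of_nodup (nodup_roots hsep),
    ← (IsAlgClosed.splits _).natDegree_eq_card_roots, hdeg]

theorem degreeOf_ne_zero_of_isLeader (hi : IsLeader p i) :
    p.degreeOf i ≠ 0 := MvPolynomial.mem_vars_iff_degreeOf_ne_zero.1 hi.1

end Member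

theorem IsSimple.eq_of_isLeader (hS : S.IsSimple) {p q : MvPolynomial (Fin n) ℂ} {i : Fin n}
    (hp : p ∈ S.eqs) (hpi : IsLeader p i) (hq : q ∈ S.eqs ∪ S.ineqs) (hqi : IsLeader q i) :
    q ∈ S.eqs ∧ q = p := by
  rcases hS.weaklyTriangular.2 i with ⟨h1, h2⟩ | h
  · rcases hq with hq | hq
    · exact ⟨hq, h1 ⟨hq, hqi⟩ ⟨hp, hpi⟩⟩
    · exact (Set.eq_empty_iff_forall_notMem.1 h2 q ⟨hq, hqi⟩).elim
  · exact (Set.eq_empty_iff_forall_notMem.1 h p ⟨hp, hpi⟩).elim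

theorem IsSimple.admissible_of_equation (hS : S.IsSimple) {p : MvPolynomial (Fin n) ℂ}
    (hp : p ∈ S.eqs) {i : Fin n} (hi : IsLeader p i) {a : Fin n → ℂ}
    (ha : a ∈ S.partialSolutions i) : S.admissible a i = rootSet i a p := by
  ext t
  rw [Finset.mem_coe, hS.mem_rootSet (Or.inl hp) hi ha]
  constructor
  · exact fun h => h.1 p hp hi
  · intro h
    refine ⟨fun q hq hqi => ?_, fun q hq hqi => ?_⟩
    · rwa [(hS.eq_of_isLeader hp hi (Or.inl hq) hqi).2]
    · have hq' := (hS.eq_of_isLeader hp hi (Or.inr hq) hqi).1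
      rcases hS.weaklyTriangular.2 i with ⟨-, h2⟩ | h2
      · exact (Set.eq_empty_iff_forall_notMem.1 h2 q ⟨hq, hqi⟩).elim
      · exact (Set.eq_empty_iff_forall_notMem.1 h2 q ⟨hq', hqi⟩).elim

theorem IsSimple.compl_admissible (hS : S.IsSimple) {i : Fin n}
    (hi : ∀ p ∈ S.eqs, ¬ IsLeader p i) {a : Fin n → ℂ} (ha : a ∈ S.partialSolutions i) :
    (S.admissible a i)ᶜ = ⋃ p ∈ {p ∈ S.ineqs | IsLeader p i}, (rootSet i a p : Set ℂ) := by
  ext t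
  simp only [Set.mem_compl_iff, admissible, Set.mem_ofPred_eq, not_and, Set.mem_iUnion,
    Finset.mem_coe]
  constructor
  · intro h
    have h' := h fun p hp hpi => (hi p hp hpi).elim
    push Not at h'
    obtain ⟨p, hp, hpi, hpt⟩ := h'
    exact ⟨p, ⟨hp, hpi⟩, (hS.mem_rootSet (Or.inr hp) hpi ha).2 hpt⟩
  · rintro ⟨p, ⟨hp, hpi⟩, hpt⟩ - h
    exact h p hp hpi ((hS.mem_rootSet (Or.inr hp) hpi ha).1 hpt)

theorem IsSimple.countable_compl_admissible (hS : S.IsSimple) {i : Fin n}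
    (hi : ∀ p ∈ S.eqs, ¬ IsLeader p i) {a : Fin n → ℂ} (ha : a ∈ S.partialSolutions i) :
    (S.admissible a i)ᶜ.Countable := by
  rw [hS.compl_admissible hi ha]
  exact (S.countable_ineqs.mono (Set.sep_subset _ _)).biUnion fun p _ =>
    (rootSet i a p).countable_toSet

theorem IsSimple.disjoint_rootSet (hS : S.IsSimple) {i : Fin n} {a : Fin n → ℂ}
    (ha : a ∈ S.partialSolutions i) {p q : MvPolynomial (Fin n) ℂ}
    (hp : p ∈ S.ineqs) (hpi : IsLeader p i) (hq : q ∈ S.ineqs) (hqi : IsLeader q i) (hpq : p ≠ q) :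
    Disjoint (rootSet i a p) (rootSet i a q) := by
  rw [Finset.disjoint_left]
  intro t htp htq
  rw [hS.mem_rootSet (Or.inr hp) hpi ha] at htp
  rw [hS.mem_rootSet (Or.inr hq) hqi ha] at htq
  -- Disjointness is assumed at points of ℂⁿ, so `t` is put into coordinate `i`, which the subsystem
  -- below `i` does not see.
  have hu : Function.update a i t ∈ (S.below i).solutions := by
    rw [below_solutions]
    have hv : ∀ p : MvPolynomial (Fin n) ℂ, (∀ j ∈ p.vars, (j : ℕ) < i) →
        MvPolynomial.eval (Function.update a i t) p = MvPolynomial.eval a p := fun p h =>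
      eval_congr_vars fun j hj => Function.update_of_ne (Fin.ne_of_lt (h j hj)) _ _
    refine ⟨fun p hp h => ?_, fun p hp h => ?_⟩
    · rw [hv p h]
      exact ha.1 p hp h
    · rw [hv p h]
      exact ha.2 p hp h
  have hagree : ∀ j < i, Function.update a i t j = a j := fun j hj =>
    Function.update_of_ne hj.ne _ _
  refine hS.disjointInequations p hp q hq hpq i hpi hqi _ hu ⟨?_, ?_⟩
  · rw [← eval_specialize_of_agree hpi hagree, Function.update_self]
    exact htp
  · rw [← eval_specialize_of_agree hqi hagree, Function.update_self]
    exact htq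

theorem IsSimple.admissible_nonempty (hS : S.IsSimple) {i : Fin n} {a : Fin n → ℂ}
    (ha : a ∈ S.partialSolutions i) : (S.admissible a i).Nonempty := by
  by_cases h : ∃ p ∈ S.eqs, IsLeader p i
  · obtain ⟨p, hp, hi⟩ := h
    rw [hS.admissible_of_equation hp hi ha, Finset.coe_nonempty, ← Finset.card_pos,
      hS.card_rootSet (Or.inl hp) hi ha]
    exact Nat.pos_of_ne_zero (degreeOf_ne_zero_of_isLeader hi)
  · push Not at h
    obtain ⟨t, ht⟩ := exists_notMem_countable (hS.countable_compl_admissible h ha)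
    exact ⟨t, not_not.1 ht⟩

/-- Every partial solution has an admissible next value. Therefore the next values of the full
solution set are exactly the admissible ones. -/
theorem IsSimple.exists_extension (hS : S.IsSimple) {k : ℕ} {a : Fin n → ℂ} (hk : k ≤ n)
    (ha : a ∈ S.partialSolutions k) : ∃ b ∈ S.solutions, ∀ j : Fin n, (j : ℕ) < k → b j = a j := by
  induction hk using Nat.decreasingInduction generalizing a with
  | self => exact ⟨a, S.partialSolutions_eq_solutions ▸ ha, fun _ _ => rfl⟩
  | of_succ k hk ih =>
    obtain ⟨t, ht⟩ := hS.admissible_nonempty (i := ⟨k, hk⟩) ha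
    have hagree : ∀ j < (⟨k, hk⟩ : Fin n), Function.update a ⟨k, hk⟩ t j = a j := fun j hj =>
      Function.update_of_ne hj.ne _ _
    obtain ⟨b, hb, hba⟩ := ih (mem_partialSolutions_succ (i := ⟨k, hk⟩) ha
      (b := Function.update a ⟨k, hk⟩ t) (by rwa [Function.update_self]) hagree)
    refine ⟨b, hb, fun j hj => ?_⟩
    rw [hba j (Nat.lt_succ_of_lt hj), hagree j hj]

theorem IsSimple.solutions_nonempty (hS : S.IsSimple) : S.solutions.Nonempty :=
  let ⟨b, hb, _⟩ := hS.exists_extension (a := 0) (Nat.zero_le n)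
    (hS.partialSolutions_zero ▸ Set.mem_univ _)
  ⟨b, hb⟩

theorem mem_partialSolutions_of_mem_solutions {a : Fin n → ℂ} (ha : a ∈ S.solutions) (k : ℕ) :
    a ∈ S.partialSolutions k :=
  ⟨fun p hp _ => ha.1 p hp, fun p hp _ => ha.2 p hp⟩

theorem IsSimple.nextValues_solutions (hS : S.IsSimple) {a : Fin n → ℂ} (ha : a ∈ S.solutions)
    (i : Fin n) : nextValues S.solutions a i = S.admissible a i := by
  have ha' := mem_partialSolutions_of_mem_solutions ha i
  ext t
  constructor
  · rintro ⟨b, hb, hba, rfl⟩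
    refine ⟨fun p hp hi => ?_, fun p hp hi => ?_⟩
    · rw [eval_specialize_of_agree hi hba]
      exact hb.1 p hp
    · rw [eval_specialize_of_agree hi hba]
      exact hb.2 p hp
  · intro ht
    have hagree : ∀ j < i, Function.update a i t j = a j := fun j hj =>
      Function.update_of_ne hj.ne _ _
    obtain ⟨b, hb, hba⟩ := hS.exists_extension (Nat.succ_le_of_lt i.2)
      (mem_partialSolutions_succ ha' (b := Function.update a i t)
        (by rwa [Function.update_self]) hagree)
    refine ⟨b, hb, fun j hj => ?_, ?_⟩
    · rw [hba j (Nat.lt_succ_of_lt hj), hagree j hj]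
    · rw [hba i (Nat.lt_succ_self _), Function.update_self]

theorem finite_setOf_apply_zero_mem {s : Set ℂ} (hs : s.Finite) :
    {u : Fin 1 → ℂ | u 0 ∈ s}.Finite ∧ {u : Fin 1 → ℂ | u 0 ∈ s}.ncard = s.ncard := by
  have e : {u : Fin 1 → ℂ | u 0 ∈ s} = (fun (t : ℂ) (_ : Fin 1) => t) '' s := by
    ext u
    constructor
    · refine fun hu => ⟨u 0, hu, ?_⟩
      ext j
      rw [Fin.fin_one_eq_zero j]
    · rintro ⟨t, ht, rfl⟩
      exact ht
  rw [e]
  exact ⟨hs.image _, Set.ncard_image_of_injective _ fun s t h => congrFun h 0⟩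

theorem isConstructible_of_finite_fin_one {s : Set ℂ} (hs : s.Finite) :
    IsConstructible {u : Fin 1 → ℂ | u 0 ∈ s} := by
  have e : {u : Fin 1 → ℂ | u 0 ∈ s} = ⋃ t ∈ s, {u : Fin 1 → ℂ | MvPolynomial.eval u
      (MvPolynomial.X 0 - MvPolynomial.C t) = 0} := by
    ext u
    simp [sub_eq_zero]
  rw [e]
  exact IsConstructible.biUnion hs fun t _ => IsConstructible.zeroSet _

/-- The admissible values have a value independent of `a`: the degree of the equation, `∞` minus the
total degree of finitely many inequations, or `∞ - ℵ₀` for infinitely many. -/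
theorem IsSimple.exists_isAlgCounting (hS : S.IsSimple) : ∃ p, IsAlgCounting S.solutions p := by
  refine exists_isAlgCounting_of_nextValues fun i => ?_
  suffices ∃ c, ∀ a ∈ S.partialSolutions i,
      IsAlgCounting {u : Fin 1 → ℂ | u 0 ∈ S.admissible a i} c by
    obtain ⟨c, hc⟩ := this
    refine ⟨c, fun a ha => ?_⟩
    rw [hS.nextValues_solutions ha]
    exact hc a (mem_partialSolutions_of_mem_solutions ha i)
  classical
  by_cases h : ∃ p ∈ S.eqs, IsLeader p i
  · obtain ⟨p, hp, hi⟩ := h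
    refine ⟨inclusion (C (p.degreeOf i : ℤ)), fun a ha => ?_⟩
    rw [hS.admissible_of_equation hp hi ha]
    have hfin := finite_setOf_apply_zero_mem (rootSet i a p).finite_toSet
    refine IsAlgCounting.constructible _ _
      (isConstructible_of_finite_fin_one (rootSet i a p).finite_toSet) ?_
    rw [← hS.card_rootSet (Or.inl hp) hi ha, ← Set.ncard_coe_finset, ← hfin.2]
    exact IsPleskenCounting.finite _ hfin.1
  · push Not at h
    have hcompl : ∀ a, {u : Fin 1 → ℂ | u 0 ∈ S.admissible a i} =
        {u : Fin 1 → ℂ | u 0 ∈ (S.admissible a i)ᶜ}ᶜ := fun a => by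
      ext u
      simp
    by_cases hfin : {p ∈ S.ineqs | IsLeader p i}.Finite
    · refine ⟨inclusion (X - C ((∑ p ∈ hfin.toFinset, p.degreeOf i : ℕ) : ℤ)), fun a ha => ?_⟩
      have hU : (S.admissible a i)ᶜ = (hfin.toFinset.biUnion (rootSet i a) : Set ℂ) := by
        rw [hS.compl_admissible h ha]
        ext t
        simp
      have hcard : (hfin.toFinset.biUnion (rootSet i a)).card =
          ∑ p ∈ hfin.toFinset, p.degreeOf i := by
        rw [Finset.card_biUnion]
        · refine Finset.sum_congr rfl fun p hp => ?_
          rw [Set.Finite.mem_toFinset] at hp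
          exact hS.card_rootSet (Or.inr hp.1) hp.2 ha
        · intro p hp q hq hpq
          rw [Finset.mem_coe, Set.Finite.mem_toFinset] at hp hq
          exact hS.disjoint_rootSet ha hp.1 hp.2 hq.1 hq.2 hpq
      have hf := finite_setOf_apply_zero_mem (hfin.toFinset.biUnion (rootSet i a)).finite_toSet
      have hc := isConstructible_of_finite_fin_one
        (hfin.toFinset.biUnion (rootSet i a)).finite_toSet
      rw [← hcard, ← Set.ncard_coe_finset, ← hf.2, hcompl, hU]
      refine IsAlgCounting.constructible _ _ hc.compl ?_
      have := IsPleskenCounting.of_compl_finite hc.compl (by rw [compl_compl]; exact hf.1)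
      rwa [compl_compl] at this
    · refine ⟨infty - aleph, fun a ha => ?_⟩
      rw [hcompl]
      refine IsAlgCounting.cocountable _ ?_ ?_
      · have hinj : Function.Injective fun u : Fin 1 → ℂ => u 0 := fun u v huv => by
          ext j
          rw [Fin.fin_one_eq_zero j]
          exact huv
        exact (hS.countable_compl_admissible h ha).preimage hinj
      · intro hf
        have hf' : (S.admissible a i)ᶜ.Finite :=
          (hf.image fun u => u 0).subset fun t ht => ⟨fun _ => t, ht, rfl⟩
        refine hfin ?_
        have hne : ∀ p ∈ {p ∈ S.ineqs | IsLeader p i}, (rootSet i a p).Nonempty := fun p hp => by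
          rw [← Finset.card_pos, hS.card_rootSet (Or.inr hp.1) hp.2 ha]
          exact Nat.pos_of_ne_zero (degreeOf_ne_zero_of_isLeader hp.2)
        -- Choosing one zero of each inequation is injective, the zero sets being disjoint. A finite
        -- complement would therefore leave finitely many inequations.
        refine Set.Finite.of_finite_image
          (f := fun p => if hp : (rootSet i a p).Nonempty then hp.choose else 0)
          (hf'.subset ?_) ?_
        · rintro _ ⟨p, hp, rfl⟩
          rw [hS.compl_admissible h ha]
          simp only [dif_pos (hne p hp)]
          exact Set.mem_biUnion hp (Finset.mem_coe.2 (hne p hp).choose_spec)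
        · intro p hp q hq hpq
          simp only [dif_pos (hne p hp), dif_pos (hne q hq)] at hpq
          by_contra hpq'
          refine Finset.disjoint_left.1 (hS.disjoint_rootSet ha hp.1 hp.2 hq.1 hq.2 hpq')
            (hne p hp).choose_spec ?_
          rw [hpq]
          exact (hne q hq).choose_spec

end SigmaSystem

end CountingPoly

namespace CountingPoly

open Polynomial

/-! ### The leading term for the solutions of a simple system and for their closure -/

theorem isConstructible_zariskiClosure {n : ℕ} (V : Set (Fin n → ℂ)) :
    IsConstructible (zariskiClosure V) := IsConstructible.zeroLocus _

theorem subset_zariskiClosure {n : ℕ} (V : Set (Fin n → ℂ)) : V ⊆ zariskiClosure V :=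
  MvPolynomial.zeroLocus_vanishingIdeal_le V

theorem zariskiDim_zariskiClosure {n : ℕ} (V : Set (Fin n → ℂ)) :
    zariskiDim (zariskiClosure V) =
      ringKrullDim (MvPolynomial (Fin n) ℂ ⧸ MvPolynomial.vanishingIdeal ℂ V) := by
  have : MvPolynomial.vanishingIdeal ℂ (zariskiClosure V) = MvPolynomial.vanishingIdeal ℂ V :=
    MvPolynomial.zeroLocus_vanishingIdeal_galoisConnection.u_l_u_eq_u (OrderDual.toDual V)
  rw [zariskiDim, this]

theorem LeadEq.of_leadEq {q q' : ℕ[X]} {c : ℤ[X]} (h : LeadEq c q) (h' : LeadEq c q') :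
    LeadEq q q' :=
  ⟨h.1.symm.trans h'.1, by
    have := h.2.symm.trans h'.2
    exact_mod_cast this⟩

theorem lt_of_add_one_le_natCast {x : WithBot ℕ∞} {d : ℕ} (h : x + 1 ≤ d) : x < d := by
  induction x with
  | bot => exact WithBot.bot_lt_coe _
  | coe y =>
    induction y with
    | top =>
      have h' : (⊤ : ℕ∞) + 1 ≤ (d : ℕ∞) := WithBot.coe_le_coe.1 h
      exact absurd (top_le_iff.1 ((top_add (1 : ℕ∞)).symm.le.trans h')) (ENat.natCast_ne_top d)
    | coe k =>
      have h' : ((k + 1 : ℕ) : WithBot ℕ∞) ≤ d := by exact_mod_cast h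
      have : k + 1 ≤ d := by exact_mod_cast h'
      exact_mod_cast (show k < d by omega)

namespace SigmaSystem

variable {n : ℕ} {S : SigmaSystem n}

open Classical in
/-- The degree in `y_i` of the equation of `S` with leader `y_i`, and `0` if there is none. -/
noncomputable def equationDegree (S : SigmaSystem n) (i : Fin n) : ℕ :=
  if h : ∃ p ∈ S.eqs, IsLeader p i then h.choose.degreeOf i else 0

theorem exists_equation {i : Fin n} (h : S.equationDegree i ≠ 0) :
    ∃ p ∈ S.eqs, IsLeader p i ∧ p.degreeOf i = S.equationDegree i := by
  unfold equationDegree at h ⊢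
  split_ifs at h ⊢ with he
  · exact ⟨_, he.choose_spec.1, he.choose_spec.2, rfl⟩
  · exact (h rfl).elim

theorem not_isLeader_of_equationDegree_eq_zero {i : Fin n} (h : S.equationDegree i = 0) :
    ∀ p ∈ S.eqs, ¬ IsLeader p i := by
  intro p hp hi
  have he : ∃ p ∈ S.eqs, IsLeader p i := ⟨p, hp, hi⟩
  rw [equationDegree, dif_pos he] at h
  exact degreeOf_ne_zero_of_isLeader he.choose_spec.2 h

theorem IsSimple.eval_initial_ne_zero (hS : S.IsSimple) {p : MvPolynomial (Fin n) ℂ}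
    (hp : p ∈ S.eqs) {i : Fin n} (hi : IsLeader p i) {a : Fin n → ℂ} (ha : a ∈ S.solutions) :
    MvPolynomial.eval a (initial i p) ≠ 0 :=
  hS.nonvanishingInitials p (Or.inl hp) i hi a
    (S.below_solutions i ▸ mem_partialSolutions_of_mem_solutions ha i)

/-- The superset `V` will be the solution set itself and its Zariski closure. -/
theorem IsSimple.leadAtLeast (hS : S.IsSimple) {V : Set (Fin n → ℂ)} (hV : S.solutions ⊆ V)
    {q : ℕ[X]} (hq : HasLead V q) :
    LeadAtLeast q (freeCount S.equationDegree) (sheetCount S.equationDegree) := by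
  refine hq.leadAtLeast _ hV hS.solutions_nonempty (fun i hi a ha => ?_) fun i hi a ha => ?_
  · rw [hS.nextValues_solutions ha]
    exact hS.countable_compl_admissible (not_isLeader_of_equationDegree_eq_zero hi)
      (mem_partialSolutions_of_mem_solutions ha i)
  · obtain ⟨p, hp, hpi, hd⟩ := exists_equation hi
    have ha' := mem_partialSolutions_of_mem_solutions ha i
    rw [hS.nextValues_solutions ha, hS.admissible_of_equation hp hpi ha',
      Set.encard_coe_eq_coe_finsetCard, hS.card_rootSet (Or.inl hp) hpi ha', hd]

theorem IsSimple.leadEq_solutions (hS : S.IsSimple) {q : ℕ[X]} (hq : HasLead S.solutions q) :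
    LeadEq q (C (sheetCount S.equationDegree) * X ^ freeCount S.equationDegree) := by
  refine LeadAtMost.eq_of_leadAtLeast (sheetCount_pos _) ?_ (hS.leadAtLeast subset_rfl hq)
  refine hq.leadAtMost_of_isLeader _ fun i hi => ?_
  obtain ⟨p, hp, hpi, hd⟩ := exists_equation hi
  exact ⟨p, hpi, hd, fun a ha => ⟨ha.1 p hp, hS.eval_initial_ne_zero hp hpi ha⟩⟩

theorem mk_mem_nonZeroDivisors {h : MvPolynomial (Fin n) ℂ} {V : Set (Fin n → ℂ)}
    (hh : ∀ a ∈ V, MvPolynomial.eval a h ≠ 0) :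
    Ideal.Quotient.mk (MvPolynomial.vanishingIdeal ℂ V) h ∈
      nonZeroDivisors (MvPolynomial (Fin n) ℂ ⧸ MvPolynomial.vanishingIdeal ℂ V) := by
  rw [mem_nonZeroDivisors_iff_right]
  intro x hx
  obtain ⟨f, rfl⟩ := Ideal.Quotient.mk_surjective x
  rw [← map_mul, Ideal.Quotient.eq_zero_iff_mem] at hx
  rw [Ideal.Quotient.eq_zero_iff_mem]
  intro a ha
  have := hx a ha
  rw [map_mul, mul_eq_zero] at this
  exact this.resolve_right (hh a ha)

theorem IsSimple.ringKrullDim_le (hS : S.IsSimple) :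
    ringKrullDim (MvPolynomial (Fin n) ℂ ⧸ MvPolynomial.vanishingIdeal ℂ S.solutions) ≤
      freeCount S.equationDegree := by
  classical
  have hex : ∀ i, ∃ p, S.equationDegree i ≠ 0 → p ∈ S.eqs ∧ IsLeader p i := by
    intro i
    by_cases hi : S.equationDegree i = 0
    · exact ⟨0, fun h => (h hi).elim⟩
    · obtain ⟨p, hp, hpi, -⟩ := exists_equation hi
      exact ⟨p, fun _ => ⟨hp, hpi⟩⟩
  choose p hp using hex
  rw [freeCount_eq_card S.equationDegree (Finset.univ.filter fun i => S.equationDegree i = 0)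
    fun i => by simp]
  refine ringKrullDim_quotient_le_card _ p fun i hi => ?_
  have hi' : S.equationDegree i ≠ 0 := by simpa using hi
  exact ⟨fun a ha => ha.1 _ (hp i hi').1, (hp i hi').2,
    mk_mem_nonZeroDivisors fun a ha => hS.eval_initial_ne_zero (hp i hi').1 (hp i hi').2 ha⟩

/-- The closure is split along `h = 0`, with `h` the product of the initials of the equations: the
part off `h = 0` obeys the required bound and the rest has smaller degree. -/
theorem IsSimple.leadEq_closure (hS : S.IsSimple) {q : ℕ[X]} {c : ℤ[X]}
    (hc : HasCount (zariskiClosure S.solutions) c) (hq : HasLead (zariskiClosure S.solutions) q)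
    (hcq : LeadEq c q) :
    LeadEq q (C (sheetCount S.equationDegree) * X ^ freeCount S.equationDegree) := by
  refine LeadAtMost.eq_of_leadAtLeast (sheetCount_pos _) ?_
    (hS.leadAtLeast (subset_zariskiClosure _) hq)
  classical
  set I := MvPolynomial.vanishingIdeal ℂ S.solutions with hI
  set d := freeCount S.equationDegree with hd
  have hex : ∀ i, ∃ p, S.equationDegree i ≠ 0 →
      p ∈ S.eqs ∧ IsLeader p i ∧ p.degreeOf i = S.equationDegree i := by
    intro i
    by_cases hi : S.equationDegree i = 0
    · exact ⟨0, fun h => (h hi).elim⟩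
    · obtain ⟨p, hp⟩ := exists_equation hi
      exact ⟨p, fun _ => hp⟩
  choose p hp using hex
  set h := ∏ i with S.equationDegree i ≠ 0, initial i (p i) with hh
  have hhS : ∀ a ∈ S.solutions, MvPolynomial.eval a h ≠ 0 := by
    intro a ha
    rw [hh, map_prod, Finset.prod_ne_zero_iff]
    intro i hi
    have hi' := (Finset.mem_filter.1 hi).2
    exact hS.eval_initial_ne_zero (hp i hi').1 (hp i hi').2.1 ha
  set V := zariskiClosure S.solutions \ {a | MvPolynomial.eval a h = 0} with hV
  have hVc : IsConstructible V :=
    (isConstructible_zariskiClosure _).diff (IsConstructible.zeroSet h)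
  obtain ⟨c₁, hc₁⟩ := hVc.exists_hasCount
  obtain ⟨c₂, hc₂⟩ := (IsConstructible.zeroLocus (I ⊔ Ideal.span {h})).exists_hasCount
  obtain ⟨q₁, hq₁, hcq₁⟩ := hc₁.exists_hasLead
  obtain ⟨q₂, hq₂, hcq₂⟩ := hc₂.exists_hasLead
  have hmem : ∀ a, a ∈ MvPolynomial.zeroLocus ℂ (I ⊔ Ideal.span {h}) ↔
      a ∈ zariskiClosure S.solutions ∧ MvPolynomial.eval a h = 0 := fun a =>
    mem_zeroLocus_sup_span
  have hdisj : Disjoint V (MvPolynomial.zeroLocus ℂ (I ⊔ Ideal.span {h})) :=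
    Set.disjoint_left.2 fun a ha ha' => ha.2 ((hmem a).1 ha').2
  have hun : V ∪ MvPolynomial.zeroLocus ℂ (I ⊔ Ideal.span {h}) = zariskiClosure S.solutions := by
    ext a
    rw [Set.mem_union, hmem, hV, Set.mem_sdiff, Set.mem_ofPred_eq]
    tauto
  have hsum := (hc₁.degree_le_union hc₂ hdisj).1
  rw [hun] at hsum
  rw [hc.unique hsum] at hcq
  refine LeadEq.leadAtMost ((hcq₁.add hcq₂).of_leadEq hcq) ?_
  -- The equations hold on the whole closure, and on `V` their initials do not vanish.
  have h1 : LeadAtMost q₁ d (sheetCount S.equationDegree) := by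
    refine hq₁.leadAtMost_of_isLeader _ fun i hi => ?_
    obtain ⟨hpS, hpi, hpd⟩ := hp i hi
    refine ⟨p i, hpi, hpd, fun a ha => ⟨ha.1 _ fun b hb => hb.1 _ hpS, fun h0 => ha.2 ?_⟩⟩
    rw [Set.mem_ofPred_eq, hh, map_prod]
    exact Finset.prod_eq_zero (Finset.mem_filter.2 ⟨Finset.mem_univ i, hi⟩) h0
  have h2 : q₂.degree < d := by
    rw [← hcq₂.1]
    refine degree_lt_of_ringKrullDim_lt d _ ?_ c₂ hc₂
    -- `h` has no zero on the solutions, so it is a nonzerodivisor modulo `I`, and adjoining it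
    -- lowers the dimension by at least one.
    have hsucc := ringKrullDim_succ_le_of_surjective
      (Ideal.Quotient.factor (S := I) (T := I ⊔ Ideal.span {h}) le_sup_left)
      (Ideal.Quotient.factor_surjective _) (mk_mem_nonZeroDivisors hhS)
      (by
        rw [Ideal.Quotient.factor_mk, Ideal.Quotient.eq_zero_iff_mem]
        exact Ideal.mem_sup_right (Ideal.mem_span_singleton_self h))
    exact lt_of_add_one_le_natCast (hsucc.trans hS.ringKrullDim_le)
  refine ⟨natDegree_add_le_of_degree_le h1.1 (natDegree_le_of_degree_le h2.le), ?_⟩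
  rw [coeff_add, coeff_eq_zero_of_degree_lt h2, add_zero]
  exact h1.2

end SigmaSystem

end CountingPoly

theorem mainTheorem5 (n : ℕ) (S : CountingPoly.SigmaSystem n) (hS : S.IsSimple) :
    (∃ p : CountingPoly.CountingRing, CountingPoly.IsAlgCounting S.solutions p) ∧
    ∃ q : Polynomial ℤ,
      CountingPoly.IsPleskenCounting (CountingPoly.zariskiClosure S.solutions) q ∧
      (∀ q' : Polynomial ℤ,
        CountingPoly.IsPleskenCounting (CountingPoly.zariskiClosure S.solutions) q' → q' = q) ∧
      ∀ p : CountingPoly.CountingRing, CountingPoly.IsAlgCounting S.solutions p →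
        p.degree = q.degree ∧
        p.leadingCoeff = Polynomial.C q.leadingCoeff ∧
        (p.natDegree : WithBot ℕ∞) =
          CountingPoly.zariskiDim (CountingPoly.zariskiClosure S.solutions) := by
  refine ⟨hS.exists_isAlgCounting, ?_⟩
  obtain ⟨q, hq⟩ := (CountingPoly.isConstructible_zariskiClosure S.solutions).exists_isPleskenCounting
  obtain ⟨r, hr, hqr⟩ := hq.hasCount.exists_hasLead
  have hq' := hqr.trans (hS.leadEq_closure hq.hasCount hr hqr)
  refine ⟨q, hq, fun q' hq' => hq'.hasCount.unique hq.hasCount, fun p hp => ?_⟩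
  obtain ⟨s, hs, hps⟩ := hp.exists_hasLead
  have hp' := hps.trans (hS.leadEq_solutions hs)
  have hN := (CountingPoly.sheetCount_pos S.equationDegree).ne'
  refine ⟨hp'.1.trans hq'.1.symm, ?_, ?_⟩
  · rw [hp'.2, hq'.2]
    simp
  · rw [CountingPoly.zariskiDim_zariskiClosure, hp'.natDegree_eq, Polynomial.natDegree_C_mul_X_pow _ _ hN]
    -- A dimension below `freeCount S.equationDegree` would force `q` to have degree below that
    -- number, which is its exact degree.
    refine le_antisymm (not_lt.1 fun hlt => ?_) hS.ringKrullDim_le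
    have := CountingPoly.degree_lt_of_ringKrullDim_lt _ _ hlt q hq.hasCount
    rw [hq'.1, Polynomial.degree_C_mul_X_pow _ hN] at this
    exact lt_irrefl _ this
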